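/- Let $n\ge 2$ and let $D$ be a grid diagram of size $n$: an $n\times n$ grid in which every column and every row contains exactly one $X$ and exactly one $O$, in different squares (the punctures). It gives a planar rectangular diagram of an oriented link, also called $D$: in each column join the $X$ and the $O$ by a vertical segment, oriented from $X$ to $O$, and in each row join the $O$ and the $X$ by a horizontal segment, oriented from $O$ to $X$, the vertical segments passing over the horizontal ones. Let $n_\pm$ be the numbers of positive and negative crossings, $w(D)=n_+-n_-$, and let $\mathrm{rot}(D)$ be the number of counterclockwise minus the number of clockwise Seifert circles of $D$. Around each vertical segment draw a narrow figure-eight: an oriented closed curve winding once clockwise around the upper and once counterclockwise around the lower endpoint, with a single transversal self-intersection, at any height between the two endpoints not lying on a row, such that it crosses each horizontal segment transversally and at most twice; the figure-eights are pairwise disjoint. Let $\mathcal G$ be the set of unordered $n$-tuples of intersection points of figure-eights and horizontal segments such that each figure-eight and each horizontal segment contains exactly one of the points, and let $\mathbf x\in\mathcal G$ consist of the intersection points nearest to the $X$'s. For $g\in\mathcal G$: - $T(g)$ is the number of pairs $(a,b)$ of points of $g$ with $a_1<b_1$ and $a_2<b_2$. - For $g,h\in\mathcal G$ let $\gamma(g,h)$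 be the loop of $n$-point configurations in the plane that starts at $g$, runs along the horizontal segments to $h$ and then along the figure-eights back to $g$, seen as a family of closed curves in the plane. The grading $Q$ is determined by $Q(\mathbf x)=0$ and by $Q(g)-Q(h)$ being the sum of the winding numbers of the curves of $\gamma(g,h)$ around all $X$'s and all $O$'s. - $J(g)=2\,(T(g)-Q(g))-2\,T(\mathbf x)+\mathrm{rot}(D)+w(D)$. An enhanced Kauffman state $s$ of $D$ is a choice of a $0$- or $1$-smoothing at each crossing together with an orientation of each resulting circle (the $0$-smoothing merges the two regions swept when the over-strand is turned counterclockwise, the $1$-smoothing merges the other two). Its quantum grading is $j(s)=\mathrm{rot}(s)+\bar\imath(s)+n_+-2n_-$, where $\mathrm{rot}(s)$ is the number of counterclockwise minus the number of clockwise circles and $\bar\imath(s)$ is the number of $1$-smoothings. For $g\in\mathcal G$ let $\overline g$ be the set of the $n$ punctures and crossings nearest to the points of $g$; each vertical and each horizontal segment contains exactly one point of $\overline g$. Orient the pieces of each vertical segment away from its point of $\overline g$ and the pieces of each horizontal segment towards its point of $\overline g$. The enhanced Kauffman state $\phi(g)$ has this orientation; a crossing not in $\overline g$ is smoothed in the only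 way coherent with it, and a crossing in $\overline g$ gets the $0$-smoothing if the figure-eight is oriented upward at the nearby point of $g$, and the $1$-smoothing if it is oriented downward. Then for every $g\in\mathcal G$ $$J(g)=j(\phi(g)).$$ -/

import Mathlib

/-- A grid diagram of size `n`: each column and each row of an `n × n` grid contains exactly one
`X` and exactly one `O`, in different squares. `X c` (resp. `O c`) is the row of the `X`
(resp. `O`) in column `c`. Columns are numbered from left to right, rows from bottom to top,
and the square in column `c` and row `r` is represented by the point `(c, r)` of the plane. -/
structure GridDiagram (n : ℕ) where
  X : Equiv.Perm (Fin n)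
  O : Equiv.Perm (Fin n)
  ne : ∀ c, X c ≠ O c

namespace GridDiagram

variable {n : ℕ} (D : GridDiagram n)

/-! ### The planar rectangular diagram

In column `c` there is a vertical segment from `(c, bot c)` to `(c, top c)`, in row `r` a horizontal
segment from `(left r, r)` to `(right r, r)`; vertical segments pass over horizontal ones. -/

/-- Height of the lower end of the vertical segment in column `c`. -/
def bot (c : Fin n) : Fin n := min (D.X c) (D.O c)

/-- Height of the upper end of the vertical segment in column `c`. -/
def top (c : Fin n) : Fin n := max (D.X c) (D.O c)

/-- Abscissa of the left end of the horizontal segment in row `r`. -/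
def left (r : Fin n) : Fin n := min (D.X.symm r) (D.O.symm r)

/-- Abscissa of the right end of the horizontal segment in row `r`. -/
def right (r : Fin n) : Fin n := max (D.X.symm r) (D.O.symm r)

/-- The crossings of the diagram: points `(c, r)` interior to both the vertical segment of column
`c` and the horizontal segment of row `r`. -/
abbrev Crossing : Type :=
  {p : Fin n × Fin n //
    (D.bot p.1 < p.2 ∧ p.2 < D.top p.1) ∧ (D.left p.2 < p.1 ∧ p.1 < D.right p.2)}

/-- The diagram cut at all points of the integer lattice (a refinement of the subdivision at the
crossings). `Sum.inl (c, k)` is the vertical edge from `(c, k)` to `(c, k + 1)`, `Sum.inr (k, r)`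
is the horizontal edge from `(k, r)` to `(k + 1, r)`. -/
abbrev Edge : Type :=
  {p : Fin n × Fin n // D.bot p.1 ≤ p.2 ∧ p.2 < D.top p.1} ⊕
    {p : Fin n × Fin n // D.left p.2 ≤ p.1 ∧ p.1 < D.right p.2}

variable {D}

/-- The point of the plane at which a crossing sits. -/
def Crossing.pt (x : D.Crossing) : ℤ × ℤ := ((x.1.1 : ℕ), (x.1.2 : ℕ))

/-- The lower (vertical edges) or left (horizontal edges) end. -/
def Edge.lo : D.Edge → ℤ × ℤ
  | .inl p => ((p.1.1 : ℕ), (p.1.2 : ℕ))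
  | .inr p => ((p.1.1 : ℕ), (p.1.2 : ℕ))

/-- The upper (vertical edges) or right (horizontal edges) end. -/
def Edge.hi : D.Edge → ℤ × ℤ
  | .inl p => ((p.1.1 : ℕ), (p.1.2 : ℕ) + 1)
  | .inr p => ((p.1.1 : ℕ) + 1, (p.1.2 : ℕ))

/-- An orientation of the edges assigns `true` to the edges oriented upward or rightward and
`false` to those oriented downward or leftward. `tail` is the initial point of an edge. -/
def Edge.tail (o : D.Edge → Bool) (e : D.Edge) : ℤ × ℤ := if o e then e.lo else e.hi

/-- The final point of an oriented edge. -/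
def Edge.head (o : D.Edge → Bool) (e : D.Edge) : ℤ × ℤ := if o e then e.hi else e.lo

variable (D)

/-! ### Resolutions and enhanced Kauffman states

A resolution assigns to each crossing its `0`-smoothing (`false`) or its `1`-smoothing (`true`).
Turning the over-strand (the vertical one) counterclockwise sweeps the north-west and south-east
regions; the `0`-smoothing merges these two regions, that is, it joins the north arm with the east
arm and the south arm with the west arm. The `1`-smoothing joins north with west and south with
east. -/

/-- In the resolution `s` the two distinct edges `e`, `f` follow each other at the lattice
point `v`. At a crossing one of them is vertical, the other one horizontal, and `0`-smoothings join
arms which both start or both end at `v`. -/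
def JoinedAt (s : D.Crossing → Bool) (v : ℤ × ℤ) (e f : D.Edge) : Prop :=
  e ≠ f ∧ (e.lo = v ∨ e.hi = v) ∧ (f.lo = v ∨ f.hi = v) ∧
    ∀ x : D.Crossing, x.pt = v →
      e.isLeft ≠ f.isLeft ∧ (s x = false ↔ (e.lo = v ↔ f.lo = v))

/-- The graph on the edges in which edges following each other in the resolution `s` are
adjacent. -/
def resolutionGraph (s : D.Crossing → Bool) : SimpleGraph D.Edge where
  Adj e f := ∃ v, D.JoinedAt s v e f
  symm := by
    constructor
    rintro e f ⟨v, hne, he, hf, h⟩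
    exact ⟨v, hne.symm, hf, he, fun x hx =>
      ⟨(h x hx).1.symm, (h x hx).2.trans ⟨Iff.symm, Iff.symm⟩⟩⟩
  loopless := by
    constructor
    rintro e ⟨v, hne, -⟩
    exact hne rfl

/-- The circles of the resolution `s`. -/
abbrev Circle (s : D.Crossing → Bool) : Type := (D.resolutionGraph s).ConnectedComponent

/-- An enhanced Kauffman state: a resolution together with an orientation of each of its circles,
i.e. an orientation of all edges such that, wherever two edges follow each other, one of them comes
in and the other one goes out. -/
structure KauffmanState where
  smoothing : D.Crossing → Bool
  orient : D.Edge → Bool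
  coherent : ∀ v e f, D.JoinedAt smoothing v e f →
    (e.head orient = v ↔ f.tail orient = v)

variable {D}

namespace KauffmanState

variable (S : D.KauffmanState)

/-- The direction vector of an edge with the orientation of `S`. -/
def dir (e : D.Edge) : ℤ × ℤ := e.head S.orient - e.tail S.orient

open Classical in
/-- The total turning of the tangent along an oriented circle, in quarter turns: the number of
left turns minus the number of right turns. -/
noncomputable def turning (C : D.Circle S.smoothing) : ℤ :=
  ∑ e : D.Edge, ∑ f : D.Edge,
    if (D.resolutionGraph S.smoothing).connectedComponentMk e = C ∧
        D.JoinedAt S.smoothing (e.head S.orient) e f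
    then (S.dir e).1 * (S.dir f).2 - (S.dir e).2 * (S.dir f).1 else 0

/-- A circle is oriented counterclockwise if its tangent turns in the positive sense. -/
def IsCounterclockwise (C : D.Circle S.smoothing) : Prop := 0 < S.turning C

open Classical in
/-- The rotation number: each circle contributes `1` if it is oriented counterclockwise and `-1`
otherwise. -/
noncomputable def rot : ℤ :=
  ∑ C : D.Circle S.smoothing, if S.IsCounterclockwise C then 1 else -1

/-- The number of `1`-smoothings. -/
def numOne : ℕ := (Finset.univ.filter fun x => S.smoothing x = true).card

end KauffmanState

variable (D)

/-! ### The orientation of the diagram -/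

/-- The vertical segment in column `c` is oriented from the `X` to the `O`; is this upward? -/
def vertUp (c : Fin n) : Bool := decide (D.X c < D.O c)

/-- The horizontal segment in row `r` is oriented from the `O` to the `X`; is this rightward? -/
def horRight (r : Fin n) : Bool := decide (D.O.symm r < D.X.symm r)

/-- A crossing is positive if (over-strand, under-strand) is a positive frame: the over-strand goes
up and the under-strand to the left, or the over-strand goes down and the under-strand to the
right. -/
def Positive (x : D.Crossing) : Bool := D.vertUp x.1.1 != D.horRight x.1.2

/-- The number of positive crossings. -/
def nPlus : ℕ := (Finset.univ.filter fun x : D.Crossing => D.Positive x = true).card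

/-- The number of negative crossings. -/
def nMinus : ℕ := (Finset.univ.filter fun x : D.Crossing => D.Positive x = false).card

/-- The writhe. -/
def writhe : ℤ := ∑ x : D.Crossing, if D.Positive x = true then 1 else -1

theorem bot_lt_top (c : Fin n) : D.bot c < D.top c := by
  have := D.ne c
  simp only [bot, top, lt_sup_iff, inf_lt_iff]
  rcases lt_or_gt_of_ne this with h | h <;> simp [h]

theorem left_lt_right (r : Fin n) : D.left r < D.right r := by
  have : D.X.symm r ≠ D.O.symm r := by
    intro h
    apply D.ne (D.X.symm r)
    rw [Equiv.apply_symm_apply, h, Equiv.apply_symm_apply]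
  simp only [left, right, lt_sup_iff, inf_lt_iff]
  rcases lt_or_gt_of_ne this with h | h <;> simp [h]

/-- A point common to a vertical and a horizontal segment is a puncture or a crossing. -/
theorem corner_iff (c r : Fin n) :
    (r = D.bot c ∨ r = D.top c) ↔ (c = D.left r ∨ c = D.right r) := by
  have h1 : (r = D.bot c ∨ r = D.top c) ↔ (r = D.X c ∨ r = D.O c) := by
    unfold bot top
    rcases le_total (D.X c) (D.O c) with h | h <;> simp [h, or_comm]
  have h2 : (c = D.left r ∨ c = D.right r) ↔ (c = D.X.symm r ∨ c = D.O.symm r) := by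
    unfold left right
    rcases le_total (D.X.symm r) (D.O.symm r) with h | h <;> simp [h, or_comm]
  rw [h1, h2, Equiv.eq_symm_apply, Equiv.eq_symm_apply, eq_comm, eq_comm (a := r) (b := D.O c)]

/-- The orientation of the edges pointing away from the points `(c, row c)` on vertical segments
and towards these points on horizontal segments. -/
def orientOf (row : Equiv.Perm (Fin n)) : D.Edge → Bool
  | .inl p => decide (row p.1.1 ≤ p.1.2)
  | .inr p => decide (p.1.1 < row.symm p.1.2)

theorem coherent_orientOf (row : Equiv.Perm (Fin n))
    (hV : ∀ c, D.bot c ≤ row c ∧ row c ≤ D.top c)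
    (hH : ∀ c, D.left (row c) ≤ c ∧ c ≤ D.right (row c))
    (s : D.Crossing → Bool)
    (hs : ∀ x : D.Crossing, row x.1.1 ≠ x.1.2 →
      (s x = false ↔ (row x.1.1 < x.1.2 ↔ ¬ x.1.1 < row.symm x.1.2)))
    (v : ℤ × ℤ) (e f : D.Edge) (h : D.JoinedAt s v e f) :
    e.head (D.orientOf row) = v ↔ f.tail (D.orientOf row) = v := by
  obtain ⟨hne, he, hf, hx⟩ := h
  have hH' : ∀ r, D.left r ≤ row.symm r ∧ row.symm r ≤ D.right r := fun r => by
    simpa using hH (row.symm r)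
  have hrc : ∀ c r, row c = r ↔ c = row.symm r := fun c r => by
    rw [Equiv.eq_symm_apply]
  have hX : ∀ c r : Fin n, v = (((c : ℕ) : ℤ), ((r : ℕ) : ℤ)) → D.bot c < r → r < D.top c →
      D.left r ≤ c → c ≤ D.right r → e.isLeft ≠ f.isLeft ∧
        ∃ x : D.Crossing, x.1 = (c, r) ∧ (s x = false ↔ (e.lo = v ↔ f.lo = v)) := by
    intro c r hv h1 h2 h3 h4
    have := D.corner_iff c r
    have h5 : D.left r < c ∧ c < D.right r := by
      constructor
      · refine lt_of_le_of_ne h3 fun h => ?_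
        rcases this.2 (Or.inl h.symm) with h | h <;> simp [h] at h1 h2
      · refine lt_of_le_of_ne h4 fun h => ?_
        rcases this.2 (Or.inr h) with h | h <;> simp [h] at h1 h2
    obtain ⟨h6, h7⟩ := hx ⟨(c, r), ⟨h1, h2⟩, h5⟩ hv.symm
    exact ⟨h6, _, rfl, h7⟩
  have hVV : ∀ c r : Fin n, v = (((c : ℕ) : ℤ), ((r : ℕ) : ℤ)) → D.bot c < r → r < D.top c →
      e.isLeft = f.isLeft → row c ≠ r := by
    rintro c r hv h1 h2 h3 rfl
    exact (hX c _ hv h1 h2 (hH c).1 (hH c).2).1 h3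
  have hHH : ∀ c r : Fin n, v = (((c : ℕ) : ℤ), ((r : ℕ) : ℤ)) → D.left r < c → c < D.right r →
      e.isLeft = f.isLeft → row.symm r ≠ c := by
    rintro c r hv h1 h2 h3 h
    have h4 : row c = r := by rw [← h]; simp
    have h5 := D.corner_iff c r
    have h6 := hV c
    rw [h4] at h6
    have h7 : D.bot c < r ∧ r < D.top c := by
      constructor
      · refine lt_of_le_of_ne h6.1 fun h => ?_
        rcases h5.1 (Or.inl h.symm) with h | h <;> simp [h] at h1 h2
      · refine lt_of_le_of_ne h6.2 fun h => ?_
        rcases h5.1 (Or.inr h) with h | h <;> simp [h] at h1 h2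
    exact (hX c r hv h7.1 h7.2 h1.le h2.le).1 h3
  have hVH : ∀ c r : Fin n, v = (((c : ℕ) : ℤ), ((r : ℕ) : ℤ)) → D.bot c ≤ r → r ≤ D.top c →
      D.left r ≤ c → c ≤ D.right r →
      ((r = D.bot c ∨ r = D.top c) ∧ (c = D.left r ∨ c = D.right r)) ∨
        (row c ≠ r → ((row c < r ↔ ¬ c < row.symm r) ↔ (e.lo = v ↔ f.lo = v))) := by
    intro c r hv h1 h2 h3 h4
    have h5 := D.corner_iff c r
    by_cases h6 : r = D.bot c ∨ r = D.top c
    · exact Or.inl ⟨h6, h5.1 h6⟩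
    · right
      push Not at h6
      obtain ⟨-, x, hx1, hx2⟩ := hX c r hv (lt_of_le_of_ne h1 h6.1.symm)
        (lt_of_le_of_ne h2 h6.2) h3 h4
      intro h7
      have := hs x
      rw [hx1] at this
      exact (this h7).symm.trans hx2
  rcases e with ⟨⟨c, k⟩, hc⟩ | ⟨⟨k, r⟩, hc⟩ <;> rcases f with ⟨⟨c', k'⟩, hc'⟩ | ⟨⟨k', r'⟩, hc'⟩ <;>
    dsimp only at hc hc'
  · have hx1 := hVV c k
    have hx2 := hVV c' k'
    rcases he with rfl | rfl <;> rcases hf with hf | hf <;>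
      simp [Edge.lo, Edge.hi, Prod.ext_iff, Edge.head, Edge.tail, orientOf] at hf hx1 hx2 hne ⊢
    · omega
    · obtain ⟨h1, h2⟩ := hf
      obtain rfl := Fin.ext h1
      have := hx1 (by omega) (by omega)
      split_ifs <;> simp <;> omega
    · obtain ⟨h1, h2⟩ := hf
      obtain rfl := Fin.ext h1
      have := hx2 (by omega) (by omega) (by omega)
      split_ifs <;> simp <;> omega
    · omega
  · have hv : v = (((c : ℕ) : ℤ), ((r' : ℕ) : ℤ)) := by
      rcases he with rfl | rfl <;> rcases hf with hf | hf <;>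
        simp [Edge.lo, Edge.hi, Prod.ext_iff] at hf ⊢ <;> omega
    have h1 := hVH c r' hv
    have h2 : row c = r' ↔ c = row.symm r' := hrc c r'
    have h3 := hV c
    have h4 := hH' r'
    subst hv
    simp only [Edge.lo, Edge.hi, Prod.ext_iff, Edge.head, Edge.tail, orientOf,
      decide_eq_true_eq, true_and, and_true] at he hf h1 ⊢
    clear hx hX hVV hHH hVH hs hne
    generalize row c = ρ at *
    generalize row.symm r' = κ at *
    generalize D.bot c = b at *
    generalize D.top c = t at *
    generalize D.left r' = l at *
    generalize D.right r' = q at *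
    specialize h1 (by omega) (by omega) (by omega) (by omega)
    rcases h1 with h1 | h1
    · split_ifs <;> simp <;> omega
    · by_cases h5 : ρ = r'
      · split_ifs <;> simp <;> omega
      · specialize h1 h5
        rcases he with he | he <;> rcases hf with hf | hf <;> split_ifs <;> simp <;> omega
  · have hv : v = (((c' : ℕ) : ℤ), ((r : ℕ) : ℤ)) := by
      rcases he with rfl | rfl <;> rcases hf with hf | hf <;>
        simp [Edge.lo, Edge.hi, Prod.ext_iff] at hf ⊢ <;> omega
    have h1 := hVH c' r hv
    have h2 : row c' = r ↔ c' = row.symm r := hrc c' r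
    have h3 := hV c'
    have h4 := hH' r
    subst hv
    simp only [Edge.lo, Edge.hi, Prod.ext_iff, Edge.head, Edge.tail, orientOf,
      decide_eq_true_eq, true_and, and_true] at he hf h1 ⊢
    clear hx hX hVV hHH hVH hs hne
    generalize row c' = ρ at *
    generalize row.symm r = κ at *
    generalize D.bot c' = b at *
    generalize D.top c' = t at *
    generalize D.left r = l at *
    generalize D.right r = q at *
    specialize h1 (by omega) (by omega) (by omega) (by omega)
    rcases h1 with h1 | h1
    · split_ifs <;> simp <;> omega
    · by_cases h5 : ρ = r
      · split_ifs <;> simp <;> omega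
      · specialize h1 h5
        rcases he with he | he <;> rcases hf with hf | hf <;> split_ifs <;> simp <;> omega
  · have hx1 := hHH k r
    have hx2 := hHH k' r'
    rcases he with rfl | rfl <;> rcases hf with hf | hf <;>
      simp [Edge.lo, Edge.hi, Prod.ext_iff, Edge.head, Edge.tail, orientOf] at hf hx1 hx2 hne ⊢
    · omega
    · obtain ⟨h1, h2⟩ := hf
      obtain rfl := Fin.ext h2
      have := hx1 (by omega) (by omega)
      split_ifs <;> simp <;> omega
    · obtain ⟨h1, h2⟩ := hf
      obtain rfl := Fin.ext h2
      have := hx2 (by omega) (by omega) (by omega)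
      split_ifs <;> simp <;> omega
    · omega

theorem X_mem_vert (c : Fin n) : D.bot c ≤ D.X c ∧ D.X c ≤ D.top c :=
  ⟨min_le_left _ _, le_max_left _ _⟩

theorem X_mem_hor (c : Fin n) : D.left (D.X c) ≤ c ∧ c ≤ D.right (D.X c) := by
  simp [left, right]

/-- The oriented resolution of the diagram, whose circles are the Seifert circles: the edges carry
the orientation of the diagram, the positive crossings the `0`-smoothing and the negative crossings
the `1`-smoothing. -/
def seifertState : D.KauffmanState where
  smoothing x := !D.Positive x
  orient
    | .inl p => D.vertUp p.1.1
    | .inr p => D.horRight p.1.2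
  coherent := by
    have key : (fun e : D.Edge => match e with
        | .inl p => D.vertUp p.1.1
        | .inr p => D.horRight p.1.2) = D.orientOf D.X := by
      funext e
      rcases e with ⟨⟨c, k⟩, h⟩ | ⟨⟨k, r⟩, h⟩
      · simp only [vertUp, orientOf, bot, top] at h ⊢
        rcases le_total (D.X c) (D.O c) with h' | h' <;> simp [h'] at h <;> congr 1 <;>
          simp only [eq_iff_iff] <;> omega
      · simp only [horRight, orientOf, left, right] at h ⊢
        rcases le_total (D.X.symm r) (D.O.symm r) with h' | h' <;> simp [h'] at h <;>
          congr 1 <;> simp only [eq_iff_iff] <;> omega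
    intro v e f h
    rw [key]
    refine D.coherent_orientOf D.X D.X_mem_vert D.X_mem_hor _ ?_ v e f h
    rintro ⟨⟨c, r⟩, h⟩ hne
    have h1 : D.X.symm r ≠ c := fun h => hne (by simp [← h])
    simp only [Positive, vertUp, horRight, bot, top, left, right] at h hne ⊢
    rcases le_total (D.X c) (D.O c) with h2 | h2 <;>
      rcases le_total (D.X.symm r) (D.O.symm r) with h3 | h3 <;>
      simp [h2, h3] at h ⊢ <;> omega

/-- The rotation number of the diagram: the sum over the Seifert circles of `1` for
counterclockwise and `-1` for clockwise circles. -/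
noncomputable def rot : ℤ := D.seifertState.rot

/-- The Khovanov quantum grading of an enhanced Kauffman state. -/
noncomputable def quantumGrading (S : D.KauffmanState) : ℤ :=
  S.rot + S.numOne + D.nPlus - 2 * D.nMinus

end GridDiagram

/-! ### Plane polygonal curves -/

/-- The plane curve that runs along the polygonal line with the given successive vertices. -/
def polyline (l : List ℂ) : Set ℂ := {z | ∃ e ∈ l.zip l.tail, z ∈ segment ℝ e.1 e.2}

/-- The total variation of the angle, seen from `p`, along the polygonal line with the given
successive vertices (which is assumed not to run through `p`). -/
noncomputable def angleAlong (p : ℂ) (l : List ℂ) : ℝ :=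
  ((l.zip l.tail).map fun e => Complex.arg ((e.2 - p) / (e.1 - p))).sum

theorem segment_im_mem {a b z : ℂ} (hz : z ∈ segment ℝ a b) :
    min a.im b.im ≤ z.im ∧ z.im ≤ max a.im b.im := by
  obtain ⟨s, t, hs, ht, hst, rfl⟩ := hz
  obtain rfl : s = 1 - t := by linarith
  simp only [Complex.add_im, Complex.real_smul, Complex.mul_im, Complex.ofReal_re,
    Complex.ofReal_im, zero_mul, add_zero]
  rcases le_total a.im b.im with h | h <;> simp [h] <;> constructor <;> nlinarith

theorem mem_segment_vert {x y₁ y₂ : ℝ} (h : y₁ < y₂) (z : ℂ) :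
    z ∈ segment ℝ (⟨x, y₁⟩ : ℂ) ⟨x, y₂⟩ ↔ z.re = x ∧ y₁ ≤ z.im ∧ z.im ≤ y₂ := by
  constructor
  · intro hz
    have := segment_im_mem hz
    simp [h.le] at this
    refine ⟨?_, this⟩
    obtain ⟨s, t, hs, ht, hst, rfl⟩ := hz
    obtain rfl : s = 1 - t := by linarith
    simp
    ring
  · rintro ⟨h1, h2, h3⟩
    have : 0 < y₂ - y₁ := by linarith
    refine ⟨(y₂ - z.im) / (y₂ - y₁), (z.im - y₁) / (y₂ - y₁), by apply div_nonneg <;> linarith,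
      by apply div_nonneg <;> linarith, by field_simp; ring, ?_⟩
    apply Complex.ext <;>
      simp only [Complex.add_re, Complex.add_im, Complex.real_smul, Complex.mul_re, Complex.mul_im,
        Complex.ofReal_re, Complex.ofReal_im, h1] <;> field_simp <;> ring

theorem mem_segment_hor {x₁ x₂ y : ℝ} (h : x₁ < x₂) (z : ℂ) :
    z ∈ segment ℝ (⟨x₁, y⟩ : ℂ) ⟨x₂, y⟩ ↔ z.im = y ∧ x₁ ≤ z.re ∧ z.re ≤ x₂ := by
  constructor
  · rintro ⟨s, t, hs, ht, hst, rfl⟩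
    obtain rfl : s = 1 - t := by linarith
    simp
    refine ⟨by ring, ?_, ?_⟩ <;> nlinarith
  · rintro ⟨h1, h2, h3⟩
    have : 0 < x₂ - x₁ := by linarith
    refine ⟨(x₂ - z.re) / (x₂ - x₁), (z.re - x₁) / (x₂ - x₁), by apply div_nonneg <;> linarith,
      by apply div_nonneg <;> linarith, by field_simp; ring, ?_⟩
    apply Complex.ext <;>
      simp only [Complex.add_re, Complex.add_im, Complex.real_smul, Complex.mul_re, Complex.mul_im,
        Complex.ofReal_re, Complex.ofReal_im, h1] <;> field_simp <;> ring

namespace GridDiagram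

variable {n : ℕ} (D : GridDiagram n)

/-- The puncture `X` in column `c`, as a point of the plane. -/
def ptX (c : Fin n) : ℂ := ⟨(c : ℕ), (D.X c : ℕ)⟩

/-- The puncture `O` in column `c`, as a point of the plane. -/
def ptO (c : Fin n) : ℂ := ⟨(c : ℕ), (D.O c : ℕ)⟩

/-- The horizontal segment in row `r`, as a subset of the plane. -/
def horSegment (r : Fin n) : Set ℂ :=
  segment ℝ (⟨(D.left r : ℕ), (r : ℕ)⟩ : ℂ) ⟨(D.right r : ℕ), (r : ℕ)⟩

/-- A choice of figure-eights. Up to isotopy, the only choice is, for each vertical segment, the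
pair of consecutive rows `node c`, `node c + 1` between which the figure-eight has its
self-intersection; this choice is arbitrary. -/
structure FigureEights where
  node : Fin n → Fin n
  bot_le_node : ∀ c, D.bot c ≤ node c
  node_lt_top : ∀ c, node c < D.top c

namespace FigureEights

variable {D} (F : D.FigureEights)

/-- The figure-eight around the vertical segment in column `c`, as a closed polygonal line in its
orientation: it is of width `1 / 2`, starts at its highest point, winds once clockwise around the
puncture at the top and once counterclockwise around the puncture at the bottom of the segment, and
has one self-intersection, at height `node c + 1 / 2`. -/
noncomputable def eight (c : Fin n) : List ℂ :=
  let x : ℝ := (c : ℕ)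
  let b : ℝ := (D.bot c : ℕ)
  let m : ℝ := (F.node c : ℕ)
  let t : ℝ := (D.top c : ℕ)
  [⟨x, t + 1 / 4⟩, ⟨x + 1 / 4, t + 1 / 4⟩, ⟨x + 1 / 4, m + 3 / 4⟩, ⟨x - 1 / 4, m + 1 / 4⟩,
    ⟨x - 1 / 4, b - 1 / 4⟩, ⟨x + 1 / 4, b - 1 / 4⟩, ⟨x + 1 / 4, m + 1 / 4⟩,
    ⟨x - 1 / 4, m + 3 / 4⟩, ⟨x - 1 / 4, t + 1 / 4⟩, ⟨x, t + 1 / 4⟩]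

/-- The intersection points of the figure-eight of column `c` with the horizontal segment of
row `r`. -/
def interPoints (c r : Fin n) : Set ℂ := polyline (F.eight c) ∩ D.horSegment r

/-- The point at height `r` and at distance `1 / 4` to the right (`side = true`) or to the left
(`side = false`) of the vertical segment in column `c`. -/
noncomputable def sidePt (c r : Fin n) (side : Bool) : ℂ :=
  ⟨(c : ℕ) + (if side then 1 / 4 else -(1 / 4) : ℝ), (r : ℕ)⟩

/-- Explicit description of the intersection points. -/
theorem mem_interPoints (c r : Fin n) (z : ℂ) :
    z ∈ F.interPoints c r ↔ ∃ side : Bool, z = sidePt c r side ∧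
      (D.bot c ≤ r ∧ r ≤ D.top c) ∧
        (if side then D.left r ≤ c ∧ c < D.right r else D.left r < c ∧ c ≤ D.right r) := by
  have cast_le : ∀ {a b : ℕ}, (a : ℝ) < b + 1 → a ≤ b := fun {a b} h => by
    have h' : a < b + 1 := by exact_mod_cast h
    omega
  have hbm : ((D.bot c : ℕ) : ℝ) ≤ (F.node c : ℕ) := by exact_mod_cast F.bot_le_node c
  have hmt : ((F.node c : ℕ) : ℝ) + 1 ≤ (D.top c : ℕ) := by exact_mod_cast F.node_lt_top c
  have hlr : ((D.left r : ℕ) : ℝ) < (D.right r : ℕ) := by exact_mod_cast D.left_lt_right r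
  simp only [interPoints, Set.mem_inter_iff, horSegment, mem_segment_hor hlr, polyline, eight,
    List.tail_cons, List.zip_cons_cons, List.zip_nil_right, Set.mem_ofPred_eq, List.mem_cons,
    List.not_mem_nil, or_false, exists_eq_or_imp, exists_eq_left]
  rw [segment_symm ℝ (⟨(c : ℕ) + 1 / 4, (D.top c : ℕ) + 1 / 4⟩ : ℂ) ⟨_, (F.node c : ℕ) + 3 / 4⟩,
    segment_symm ℝ (⟨(c : ℕ) - 1 / 4, (F.node c : ℕ) + 1 / 4⟩ : ℂ) ⟨_, (D.bot c : ℕ) - 1 / 4⟩,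
    mem_segment_vert (by linarith), mem_segment_vert (by linarith),
    mem_segment_vert (by linarith), mem_segment_vert (by linarith)]
  constructor
  · rintro ⟨h, him, hl, hr⟩
    have side : ∀ σ : Bool, z.re = (c : ℕ) + (if σ then 1 / 4 else -(1 / 4) : ℝ) →
        ((D.bot c : ℕ) : ℝ) - 1 / 4 ≤ z.im → z.im ≤ (D.top c : ℕ) + 1 / 4 →
        ∃ side : Bool, z = sidePt c r side ∧ (D.bot c ≤ r ∧ r ≤ D.top c) ∧
          (if side then D.left r ≤ c ∧ c < D.right r else D.left r < c ∧ c ≤ D.right r) := by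
      intro σ h1 h2 h3
      rw [him] at h2 h3
      rw [h1] at hl hr
      refine ⟨σ, Complex.ext h1 him, ⟨cast_le (by linarith), cast_le (by linarith)⟩, ?_⟩
      cases σ
      · simp only [Bool.false_eq_true, if_false] at hl hr ⊢
        refine ⟨?_, cast_le (by linarith)⟩
        have : ((D.left r : ℕ) : ℝ) < (c : ℕ) := by linarith
        exact_mod_cast this
      · simp only [if_true] at hl hr ⊢
        refine ⟨cast_le (by linarith), ?_⟩
        have : ((c : ℕ) : ℝ) < (D.right r : ℕ) := by linarith
        exact_mod_cast this
    have no : ∀ k : ℕ, (k : ℝ) < z.im → z.im < k + 1 → False := by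
      intro k h1 h2
      rw [him] at h1 h2
      have h1' : k < (r : ℕ) := by exact_mod_cast h1
      have h2' : (r : ℕ) < k + 1 := by exact_mod_cast h2
      omega
    have no' : ((D.bot c : ℕ) : ℝ) - 1 < z.im → z.im < (D.bot c : ℕ) → False := by
      intro h1 h2
      rw [him] at h1 h2
      have h1' : (D.bot c : ℕ) < (r : ℕ) + 1 := by
        have : ((D.bot c : ℕ) : ℝ) < (r : ℕ) + 1 := by linarith
        exact_mod_cast this
      have h2' : (r : ℕ) < (D.bot c : ℕ) := by exact_mod_cast h2
      omega
    rcases h with h | h | h | h | h | h | h | h | h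
    · have := segment_im_mem h
      simp at this
      exact (no (D.top c) (by linarith) (by linarith)).elim
    · exact side true (by simp [h.1]) (by linarith) (by linarith)
    · have := segment_im_mem h
      rw [min_eq_right (by simp; linarith), max_eq_left (by simp; linarith)] at this
      simp only at this
      exact (no (F.node c) (by linarith) (by linarith)).elim
    · exact side false (by simp [h.1]; ring) (by linarith) (by linarith)
    · have := segment_im_mem h
      simp at this
      exact (no' (by linarith) (by linarith)).elim
    · exact side true (by simp [h.1]) (by linarith) (by linarith)
    · have := segment_im_mem h
      rw [min_eq_left (by simp; linarith), max_eq_right (by simp; linarith)] at this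
      simp only at this
      exact (no (F.node c) (by linarith) (by linarith)).elim
    · exact side false (by simp [h.1]; ring) (by linarith) (by linarith)
    · have := segment_im_mem h
      simp at this
      exact (no (D.top c) (by linarith) (by linarith)).elim
  · rintro ⟨σ, rfl, ⟨h1, h2⟩, h3⟩
    have h1' : ((D.bot c : ℕ) : ℝ) ≤ (r : ℕ) := by exact_mod_cast h1
    have h2' : ((r : ℕ) : ℝ) ≤ (D.top c : ℕ) := by exact_mod_cast h2
    cases σ
    · simp only [Bool.false_eq_true, if_false] at h3
      have h3' : ((D.left r : ℕ) : ℝ) + 1 ≤ (c : ℕ) := by exact_mod_cast h3.1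
      have h4' : ((c : ℕ) : ℝ) ≤ (D.right r : ℕ) := by exact_mod_cast h3.2
      refine ⟨?_, rfl, by simp [sidePt]; linarith, by simp [sidePt]; linarith⟩
      rcases le_or_gt (r : ℕ) (F.node c : ℕ) with h | h
      · have h' : ((r : ℕ) : ℝ) ≤ (F.node c : ℕ) := by exact_mod_cast h
        right; right; right; left
        refine ⟨?_, ?_, ?_⟩ <;> simp [sidePt] <;> linarith
      · have h' : ((F.node c : ℕ) : ℝ) + 1 ≤ (r : ℕ) := by exact_mod_cast h
        right; right; right; right; right; right; right; left
        refine ⟨?_, ?_, ?_⟩ <;> simp [sidePt] <;> linarith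
    · simp only [if_true] at h3
      have h3' : ((D.left r : ℕ) : ℝ) ≤ (c : ℕ) := by exact_mod_cast h3.1
      have h4' : ((c : ℕ) : ℝ) + 1 ≤ (D.right r : ℕ) := by exact_mod_cast h3.2
      refine ⟨?_, rfl, by simp [sidePt]; linarith, by simp [sidePt]; linarith⟩
      rcases le_or_gt (r : ℕ) (F.node c : ℕ) with h | h
      · have h' : ((r : ℕ) : ℝ) ≤ (F.node c : ℕ) := by exact_mod_cast h
        right; right; right; right; right; left
        refine ⟨?_, ?_, ?_⟩ <;> simp [sidePt] <;> linarith
      · have h' : ((F.node c : ℕ) : ℝ) + 1 ≤ (r : ℕ) := by exact_mod_cast h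
        right; left
        refine ⟨?_, ?_, ?_⟩ <;> simp [sidePt] <;> linarith

/-- The set of generators: sets of `n` intersection points of figure-eights and horizontal segments
such that each figure-eight and each horizontal segment contains exactly one of the points. Here
`pt c` is the point on the figure-eight of column `c`, and it lies on the horizontal segment of
row `row c`. -/
structure Generator where
  row : Equiv.Perm (Fin n)
  pt : Fin n → ℂ
  mem : ∀ c, pt c ∈ F.interPoints c (row c)

/-- The number of pairs `(a₁, a₂) ∈ A`, `(b₁, b₂) ∈ B` with `a₁ < b₁` and `a₂ < b₂`. -/
noncomputable def countI (A B : Finset ℂ) : ℕ := by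
  classical exact ((A ×ˢ B).filter fun q => q.1.re < q.2.re ∧ q.1.im < q.2.im).card

namespace Generator

variable {F} (g h : F.Generator)

/-- Does the point of `g` in column `c` lie to the right of the vertical segment? -/
noncomputable def side (c : Fin n) : Bool := decide (((c : ℕ) : ℝ) < (g.pt c).re)

theorem spec (c : Fin n) : g.pt c = sidePt c (g.row c) (g.side c) ∧
    (D.bot c ≤ g.row c ∧ g.row c ≤ D.top c) ∧
      (D.left (g.row c) ≤ c ∧ c ≤ D.right (g.row c)) := by
  obtain ⟨σ, h1, h2, h3⟩ := (F.mem_interPoints _ _ _).1 (g.mem c)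
  have : g.side c = σ := by
    rw [side, h1]
    cases σ <;> simp [sidePt]
  refine ⟨by rw [this, h1], h2, ?_⟩
  cases σ
  · simp only [Bool.false_eq_true, if_false] at h3
    exact ⟨h3.1.le, h3.2⟩
  · simp only [if_true] at h3
    exact ⟨h3.1, h3.2.le⟩

/-- Is the figure-eight of column `c` oriented upward at the point of `g`? This is the case on the
right below the self-intersection, and on the left above it. -/
noncomputable def upward (c : Fin n) : Bool := g.side c == decide (g.row c ≤ F.node c)

/-- The set of points of a generator. -/
noncomputable def points : Finset ℂ := by
  classical exact Finset.univ.image g.pt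

/-- The grading `T`. -/
noncomputable def T : ℕ := countI g.points g.points

/-- The polygonal path along the figure-eight of column `c` from the point of `g` up to the highest
point of the figure-eight (against its orientation if the point is on a part oriented
downward). -/
noncomputable def toTop (c : Fin n) : List ℂ :=
  let x : ℝ := (c : ℕ)
  let δ : ℝ := if g.side c then 1 / 4 else -(1 / 4)
  let m : ℝ := (F.node c : ℕ)
  let t : ℝ := (D.top c : ℕ)
  if g.row c ≤ F.node c then
    [g.pt c, ⟨x + δ, m + 1 / 4⟩, ⟨x - δ, m + 3 / 4⟩, ⟨x - δ, t + 1 / 4⟩, ⟨x, t + 1 / 4⟩]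
  else [g.pt c, ⟨x + δ, t + 1 / 4⟩, ⟨x, t + 1 / 4⟩]

/-- The loop in the configuration space that goes from `g` along the horizontal segments to `h`
and back to `g` along the figure-eights consists of `n` paths. The path starting at the point of `g`
in column `c` runs along the horizontal segment through this point to the point of `h` on that
segment, in column `c'`, and then along the figure-eight of column `c'` to the point of `g` in that
column. Together these paths form a family of closed curves. (On each figure-eight we go via its
highest point; as a full turn around a figure-eight has total winding number `1 - 1 = 0` around the
punctures, this choice does not matter.) -/
noncomputable def loopPath (c : Fin n) : List ℂ :=
  let c' := h.row.symm (g.row c)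
  g.pt c :: (h.toTop c' ++ (g.toTop c').reverse.tail)

/-- The winding number around `p` of the family of closed curves consisting of the paths
`loopPath g h c`: the total variation of the angle seen from `p`, divided by `2 * π`. -/
noncomputable def loopWinding (p : ℂ) : ℝ :=
  (∑ c, angleAlong p (g.loopPath h c)) / (2 * Real.pi)

/-- The relative grading `Q(g) - Q(h)`: the total winding number of the loop around all `X`'s and
`O`'s. -/
noncomputable def relQ : ℝ := ∑ c, (g.loopWinding h (D.ptX c) + g.loopWinding h (D.ptO c))

variable (F) in
/-- The generator formed by the intersection points nearest to the `X`'s. -/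
noncomputable def x : F.Generator where
  row := D.X
  pt c := sidePt c (D.X c) (decide (c < D.O.symm (D.X c)))
  mem c := by
    refine (F.mem_interPoints _ _ _).2 ⟨_, rfl, D.X_mem_vert c, ?_⟩
    have hne : c ≠ D.O.symm (D.X c) := by
      rw [Ne, Equiv.eq_symm_apply]
      exact (D.ne c).symm
    rcases lt_or_gt_of_ne hne with h | h
    · simp [left, right, h]
    · simp [left, right, h, h.le, not_lt.2 h.le]

/-- The grading `Q`, normalized by `Q(x) = 0`. -/
noncomputable def Q : ℝ := g.relQ (x F)

/-- Bigelow's Jones grading. -/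
noncomputable def J : ℝ := 2 * ((g.T : ℝ) - g.Q) - 2 * ((x F).T : ℝ) + D.rot + D.writhe

/-- The enhanced Kauffman state of a generator. Vertical edges point away from, horizontal edges
point towards the points `(c, row c)` (the punctures and crossings nearest to the points of `g`). A
crossing without a point of `g` nearby gets the smoothing that is coherent with this orientation. At
a crossing next to a point of `g` both smoothings are coherent; it gets the `0`-smoothing if the
point lies on a part of the figure-eight oriented upward, and the `1`-smoothing otherwise. -/
noncomputable def phi : D.KauffmanState where
  orient := D.orientOf g.row
  smoothing x :=
    if g.row x.1.1 = x.1.2 then !g.upward x.1.1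
    else decide (g.row x.1.1 < x.1.2 ↔ x.1.1 < g.row.symm x.1.2)
  coherent := by
    refine D.coherent_orientOf g.row (fun c => (g.spec c).2.1) (fun c => (g.spec c).2.2) _ ?_
    intro x hx
    simp only [hx, if_false, decide_eq_false_iff_not]
    tauto

end Generator
end FigureEights
end GridDiagram

/-!
Both gradings are sums of local contributions and of a global term, and the global terms agree.

*Rotation numbers.* The smoothed circles of a Kauffman state are disjoint simple closed curves, so
the tangent of each makes exactly one turn. This is Hopf's theorem on the turning number, proved here
in a discrete form: a circle runs through the midpoints of its edges, the secants between two of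
these points never vanish, and the rotation of the tangent is compared with that of the secants from
and to the lowest point (`LatticeCurve.turning_of_simple_closed`). Hence four times the rotation
number of a state is its number of left minus right quarter turns
(`GridDiagram.KauffmanState.four_mul_rot`). For the orientation of `φ(g)` the only contributions are
those of the corners and of the crossings next to points of `g`
(`GridDiagram.KauffmanState.four_mul_rot_of_orient`).

*The grading `Q`.* The winding number around a puncture is the number of crossings with the downward
ray from the puncture. The horizontal pieces of the loop from `g` to `h` contribute the difference of
the numbers of points of `g` and `h` to the lower left of the puncture, and the figure-eights
contribute local terms. So up to local terms `Q(g)` is the number of pairs of a point of `g` and a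
puncture to its upper right (`GridDiagram.FigureEights.Generator.relQ_eq`).

*The number of `1`-smoothings.* A crossing away from `g` gets its `1`-smoothing if and only if its
two strands point in directions of the same sign. The sum of the products of these signs is an
intersection number of the vertical and the horizontal segments, which is bilinear in the positions
of the points of `g` and of the punctures
(`GridDiagram.sum_vertWeight_mul_horWeight`). It is expressed by the number of concordant minus
discordant pairs (`Equiv.Perm.concordance`), and so are `T` and `Q`, because the asymmetric count of
pairs and its symmetric version differ only by local terms (`Equiv.Perm.four_mul_ascents`).

After this the global terms of `2 (T(g) - Q(g))` and of the quantum grading of `φ(g)` cancel, and the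
local terms at each point of `g` add up to a constant
(`GridDiagram.FigureEights.Generator.local_identity`). The remaining constant is found by taking
`g = x`, for which `φ(x)` is the oriented resolution
(`GridDiagram.FigureEights.Generator.seifertState_eq`).
-/

/-! ### The turning number of a simple closed lattice curve -/

namespace LatticeCurve

/-- The eight steps between the midpoints of consecutive edges (in doubled coordinates). -/
def IsStep (a : ℤ × ℤ) : Prop :=
  a = (2, 0) ∨ a = (1, 1) ∨ a = (0, 2) ∨ a = (-1, 1) ∨ a = (-2, 0) ∨ a = (-1, -1) ∨
    a = (0, -2) ∨ a = (1, -1)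

/-- The signed number of crossings of a short segment from `u` to `w` with a ray just below the
positive horizontal axis. For the segments considered here, the sign of `u.1 + w.1` tells on which
side of the origin the axis is crossed. -/
def rayCross (u w : ℤ × ℤ) : ℤ :=
  if 0 < u.1 + w.1 then (if u.2 < 0 then 1 else 0) - (if w.2 < 0 then 1 else 0) else 0

instance (a : ℤ × ℤ) : Decidable (IsStep a) := by unfold IsStep; infer_instance

/-- The statement of `rayCross_square` for `v` near the origin, a finite check. -/
theorem rayCross_square_of_small :
    ∀ x ∈ [-4, -3, -2, -1, 0, 1, 2, 3, 4], ∀ y ∈ [-4, -3, -2, -1, 0, 1, 2, 3, 4],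
    ∀ a ∈ [((2 : ℤ), (0 : ℤ)), (1, 1), (0, 2), (-1, 1), (-2, 0), (-1, -1), (0, -2), (1, -1)],
    ∀ b ∈ [((2 : ℤ), (0 : ℤ)), (1, 1), (0, 2), (-1, 1), (-2, 0), (-1, -1), (0, -2), (1, -1)],
    (x + y) % 2 = 0 → (x, y) ≠ ((0 : ℤ), (0 : ℤ)) → (x, y) + b ≠ 0 → (x, y) - a ≠ 0 →
    (x, y) + b - a ≠ 0 → ¬ (a.1 * b.1 = 0 ∧ a.2 * b.2 = 0 ∧ (x, y) + (x, y) + b = a) →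
    rayCross (x, y) ((x, y) + b) + rayCross ((x, y) + b) ((x, y) + b - a) =
      rayCross (x, y) ((x, y) - a) + rayCross ((x, y) - a) ((x, y) + b - a) := by
  decide +kernel

/-- A secant `v` of the curve, whose ends move by the steps `a` and `b`: if the two steps do not
meet, the parallelogram of secants swept does not contain the origin, so its boundary crosses the
ray with total multiplicity zero. The hypothesis `h5` excludes two perpendicular straight steps
with a common centre; all other meeting steps are excluded by `h1`, ..., `h4` and parity. -/
theorem rayCross_square {v a b : ℤ × ℤ} (ha : IsStep a) (hb : IsStep b)
    (hpar : (v.1 + v.2) % 2 = 0) (h1 : v ≠ 0) (h2 : v + b ≠ 0) (h3 : v - a ≠ 0) (h4 : v + b - a ≠ 0)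
    (h5 : ¬ (a.1 * b.1 = 0 ∧ a.2 * b.2 = 0 ∧ v + v + b = a)) :
    rayCross v (v + b) + rayCross (v + b) (v + b - a) =
      rayCross v (v - a) + rayCross (v - a) (v + b - a) := by
  have hab : -2 ≤ a.1 ∧ a.1 ≤ 2 ∧ -2 ≤ a.2 ∧ a.2 ≤ 2 := by
    rcases ha with rfl | rfl | rfl | rfl | rfl | rfl | rfl | rfl <;> simp
  have hbb : -2 ≤ b.1 ∧ b.1 ≤ 2 ∧ -2 ≤ b.2 ∧ b.2 ≤ 2 := by
    rcases hb with rfl | rfl | rfl | rfl | rfl | rfl | rfl | rfl <;> simp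
  obtain ⟨x, y⟩ := v
  by_cases hx : -4 ≤ x ∧ x ≤ 4
  · by_cases hy : -4 ≤ y ∧ y ≤ 4
    · -- near the origin
      refine rayCross_square_of_small x ?_ y ?_ a ?_ b ?_ hpar h1 h2 h3 h4 h5
      · simp; omega
      · simp; omega
      · simpa [IsStep] using ha
      · simpa [IsStep] using hb
    · -- the parallelogram lies above or below the axis, so no side crosses it
      simp only [rayCross, Prod.fst_add, Prod.snd_add, Prod.fst_sub, Prod.snd_sub]
      rcases not_and_or.1 hy with hy | hy
      · rw [if_pos (show y < 0 by omega), if_pos (show y + b.2 < 0 by omega),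
          if_pos (show y - a.2 < 0 by omega), if_pos (show y + b.2 - a.2 < 0 by omega)]
        simp
      · rw [if_neg (show ¬ y < 0 by omega), if_neg (show ¬ y + b.2 < 0 by omega),
          if_neg (show ¬ y - a.2 < 0 by omega), if_neg (show ¬ y + b.2 - a.2 < 0 by omega)]
        simp
  · -- no side, or every crossing of a side with the axis, is on the ray
    simp only [rayCross, Prod.fst_add, Prod.snd_add, Prod.fst_sub, Prod.snd_sub]
    rcases not_and_or.1 hx with hx | hx
    · rw [if_neg (by omega), if_neg (by omega), if_neg (by omega), if_neg (by omega)]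
    · rw [if_pos (show 0 < x + (x + b.1) by omega),
        if_pos (show 0 < x + b.1 + (x + b.1 - a.1) by omega),
        if_pos (show 0 < x + (x - a.1) by omega),
        if_pos (show 0 < x - a.1 + (x + b.1 - a.1) by omega)]
      ring

/-- The unit vectors along the axes. -/
def IsUnitDir (d : ℤ × ℤ) : Prop := d = (1, 0) ∨ d = (0, 1) ∨ d = (-1, 0) ∨ d = (0, -1)

/-- The determinant of two plane vectors. -/
def cross (d e : ℤ × ℤ) : ℤ := d.1 * e.2 - d.2 * e.1

/-- The direction of a step in eighths of a full turn. -/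
def octant (a : ℤ × ℤ) : ℤ :=
  if a.2 < 0 then (if a.1 < 0 then 5 else if a.1 = 0 then 6 else 7)
  else if a.2 = 0 then (if 0 < a.1 then 0 else 4)
  else if 0 < a.1 then 1 else if a.1 = 0 then 2 else 3

theorem isStep_add {d e : ℤ × ℤ} (hd : IsUnitDir d) (he : IsUnitDir e) (h : e ≠ -d) :
    IsStep (d + e) := by
  rcases hd with rfl | rfl | rfl | rfl <;> rcases he with rfl | rfl | rfl | rfl <;>
    revert h <;> decide

/-- Two consecutive quarter turns as the change of direction of the two steps `d + e`, `e + f`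
along the secants `d + e`, `d + 2e + f`, `e + f`, in eighths of a full turn. The last term accounts
for the jump of `octant` at the ray. -/
theorem turn_eq_octant {d e f : ℤ × ℤ} (hd : IsUnitDir d) (he : IsUnitDir e) (hf : IsUnitDir f)
    (h1 : e ≠ -d) (h2 : f ≠ -e) :
    cross d e + cross e f = octant (e + f) - octant (d + e) +
      8 * (rayCross (d + e) (d + e + (e + f)) + rayCross (d + e + (e + f)) (e + f)) := by
  rcases hd with rfl | rfl | rfl | rfl <;> rcases he with rfl | rfl | rfl | rfl <;>
    rcases hf with rfl | rfl | rfl | rfl <;> revert h1 h2 <;> decide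

/-- The contribution of the lowest point of a closed curve: the step `b` comes in, the step `a`
goes out, and `a`, `-b` both point upward (or to the right). Along the path of secants
`b`, `b + a`, `a` and its opposite the ray is crossed exactly once. -/
theorem rayCross_extremal {a b : ℤ × ℤ} (ha : IsStep a) (hb : IsStep b)
    (ha' : 0 < a.2 ∨ a.2 = 0 ∧ 0 < a.1) (hb' : b.2 < 0 ∨ b.2 = 0 ∧ b.1 < 0) (hab : a + b ≠ 0) :
    rayCross b (b + a) + rayCross (b + a) a + (rayCross (-b) (-b - a) + rayCross (-b - a) (-a)) = 1
    ∨ rayCross b (b + a) + rayCross (b + a) a +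
      (rayCross (-b) (-b - a) + rayCross (-b - a) (-a)) = -1 := by
  rcases ha with rfl | rfl | rfl | rfl | rfl | rfl | rfl | rfl <;>
    rcases hb with rfl | rfl | rfl | rfl | rfl | rfl | rfl | rfl <;>
    revert ha' hb' hab <;> decide

/-- A homotopy over the triangle of secants: the sum of a cochain along the diagonal equals
its sum along the two other sides, if it vanishes around each square. -/
theorem triangle_sum (H V : ℕ → ℕ → ℤ) (k m : ℕ)
    (hsq : ∀ i j, m ≤ i → i + 1 < j → j ≤ m + k →
      H i j + V i (j + 1) = V i j + H (i + 1) j) :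
    ∑ i ∈ Finset.range k, (H (m + i) (m + i + 1) + V (m + i) (m + i + 2)) =
      ∑ i ∈ Finset.range k, H m (m + i + 1) + ∑ i ∈ Finset.range k, V (m + i) (m + k + 1) := by
  induction k with
  | zero => simp
  | succ k ih =>
    rw [Finset.sum_range_succ, ih fun i j h1 h2 h3 => hsq i j h1 h2 (by omega)]
    -- pass from the column `m + k + 1` to the next one, square by square
    have key : ∀ l ≤ k, ∑ i ∈ Finset.range l, V (m + i) (m + k + 1) + H (m + l) (m + k + 1) =
        H m (m + k + 1) + ∑ i ∈ Finset.range l, V (m + i) (m + k + 1 + 1) := by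
      intro l hl
      induction l with
      | zero => simp
      | succ l ih' =>
        have h := hsq (m + l) (m + k + 1) (by omega) (by omega) (by omega)
        have := ih' (by omega)
        rw [Finset.sum_range_succ, Finset.sum_range_succ]
        rw [show m + (l + 1) = m + l + 1 by omega]
        linarith
    have := key k le_rfl
    rw [Finset.sum_range_succ, Finset.sum_range_succ]
    rw [show m + (k + 1) + 1 = m + k + 1 + 1 by omega, show m + k + 2 = m + k + 1 + 1 by omega]
    linarith

/-- The turning number of a simple closed lattice curve is `1` or `-1`, i.e. `4` or `-4` quarter
turns. The curve runs through the points `p i` (midpoints of unit edges in doubled coordinates) in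
the directions `d i`; it has no self-crossing and `p 0` is its lowest (and then leftmost) point.
The secants `p j - p i` with `i < j` do not vanish, so the rotation of the secant along the diagonal
`j = i + 1` can be computed along the two other sides of the triangle of secants, where it is half
a turn each, because `p 0` is extremal. -/
theorem turning_of_simple_closed {p d : ℕ → ℤ × ℤ} {N : ℕ} (hN : 3 ≤ N)
    (hp : ∀ i, p (i + N) = p i) (hd : ∀ i, d (i + N) = d i)
    (hstep : ∀ i, p (i + 1) = p i + (d i + d (i + 1)))
    (hdir : ∀ i, IsUnitDir (d i)) (hne : ∀ i, d (i + 1) ≠ -d i)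
    (hodd : ∀ i, ((p i).1 + (p i).2) % 2 = 1)
    (hinj : ∀ i j, i < j → j < N → p i ≠ p j)
    (hcross : ∀ i j, d (i + 1) = d i → d (j + 1) = d j → p i + d i = p j + d j →
      d j = d i ∨ d j = -d i)
    (hmin : ∀ i, 0 < i → i < N → (p 0).2 < (p i).2 ∨ (p i).2 = (p 0).2 ∧ (p 0).1 < (p i).1) :
    ∑ i ∈ Finset.range N, cross (d i) (d (i + 1)) = 4 ∨
      ∑ i ∈ Finset.range N, cross (d i) (d (i + 1)) = -4 := by
  set a : ℕ → ℤ × ℤ := fun i => d i + d (i + 1) with ha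
  have hstepA : ∀ i, IsStep (a i) := fun i => isStep_add (hdir i) (hdir _) (hne i)
  have hpa : ∀ i, p (i + 1) = p i + a i := hstep
  have haN : ∀ i, a (i + N) = a i := fun i => by
    simp only [ha]; rw [hd, show i + N + 1 = i + 1 + N by omega, hd]
  have hpN : p N = p 0 := by simpa using hp 0
  have hpN1 : p (N + 1) = p 1 := by rw [add_comm]; exact hp 1
  -- crossings of the secants with the ray when the second or the first end moves
  set H : ℕ → ℕ → ℤ := fun i j => rayCross (p j - p i) (p (j + 1) - p i) with hH
  set V : ℕ → ℕ → ℤ := fun i j => rayCross (p j - p i) (p j - p (i + 1)) with hV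
  have hinj' : ∀ i j, i < j → j ≤ N → (i = 0 → j ≠ N) → p j - p i ≠ 0 := by
    intro i j hij hj h0 h
    rw [sub_eq_zero] at h
    rcases hj.lt_or_eq with hj | rfl
    · exact hinj i j hij hj h.symm
    · exact hinj 0 i (Nat.pos_of_ne_zero fun h' => h0 h' rfl) hij (hpN.symm.trans h)
  have hsq : ∀ i j, i + 1 < j → j + 1 ≤ N → (i = 0 → j + 1 ≠ N) →
      H i j + V i (j + 1) = V i j + H (i + 1) j := by
    intro i j hij hj h0
    have h := rayCross_square (v := p j - p i) (hstepA i) (hstepA j) (by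
      have h1 := hodd i
      have h2 := hodd j
      simp only [Prod.fst_sub, Prod.snd_sub]
      omega) (hinj' i j (by omega) (by omega) (by omega))
      (by
        have := hinj' i (j + 1) (by omega) (by omega) h0
        rwa [hpa, add_sub_right_comm] at this)
      (by
        have := hinj' (i + 1) j (by omega) (by omega) (by omega)
        rwa [hpa, ← sub_sub] at this)
      (by
        have := hinj' (i + 1) (j + 1) (by omega) (by omega) (by omega)
        rwa [hpa, hpa i, ← sub_sub, add_sub_right_comm] at this)
      (by
        rintro ⟨h1, h2, h3⟩
        -- two perpendicular straight steps with a common centre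
        have e1 := congrArg Prod.fst h3
        have e2 := congrArg Prod.snd h3
        simp only [ha, Prod.fst_add, Prod.snd_add, Prod.fst_sub, Prod.snd_sub] at e1 e2 h1 h2
        have hc := hcross i j
        have k1 := hdir i
        have k2 := hdir (i + 1)
        have k3 := hdir j
        have k4 := hdir (j + 1)
        have n1 := hne i
        have n2 := hne j
        have hpe : p i + d i = p j + d j ↔ (p i).1 + (d i).1 = (p j).1 + (d j).1 ∧
          (p i).2 + (d i).2 = (p j).2 + (d j).2 := by rw [Prod.ext_iff]; rfl
        rw [hpe] at hc
        generalize d i = di at *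
        generalize d j = dj at *
        generalize d (i + 1) = di' at *
        generalize d (j + 1) = dj' at *
        rcases k1 with rfl | rfl | rfl | rfl <;> rcases k2 with rfl | rfl | rfl | rfl <;>
          first
          | exact absurd n1 (by decide)
          | (rcases k3 with rfl | rfl | rfl | rfl <;> rcases k4 with rfl | rfl | rfl | rfl <;>
              first
              | exact absurd n2 (by decide)
              | exact absurd h1 (by decide)
              | exact absurd h2 (by decide)
              | exact absurd (hc (by decide) (by decide) (by constructor <;> dsimp at * <;> omega))
                  (by decide)))
    simp only [hH, hV]
    rw [hpa j, hpa i]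
    rw [show p j + a j - p i = p j - p i + a j by abel,
      show p j + a j - (p i + a i) = p j - p i + a j - a i by abel,
      show p j - (p i + a i) = p j - p i - a i by abel]
    exact h
  -- the row of secants from `p 0` and the column of secants to `p 0`
  have hup : ∀ i, 0 < i → i < N → 0 ≤ (p i - p 0).2 := by
    intro i h1 h2
    have := hmin i h1 h2
    simp only [Prod.snd_sub]; omega
  have hrow : ∀ j, 0 < j → j + 1 < N → H 0 j = 0 := by
    intro j h1 h2
    have e1 := hup j h1 (by omega)
    have e2 := hup (j + 1) (by omega) h2
    simp only [hH, rayCross]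
    rw [if_neg (not_lt.2 e1), if_neg (not_lt.2 e2)]
    simp
  have hcol : ∀ i, 0 < i → i + 1 < N → V i N = 0 := by
    intro i h1 h2
    have e1 := hmin i h1 (by omega)
    have e2 := hmin (i + 1) (by omega) h2
    have s := hstepA i
    have s' := hpa i
    have o1 := hodd i
    have o2 := hodd 0
    simp only [hV, rayCross, hpN, Prod.snd_sub, Prod.fst_sub]
    rw [s'] at e2 ⊢
    simp only [Prod.fst_add, Prod.snd_add] at e2 ⊢
    generalize a i = ai at *
    rcases s with rfl | rfl | rfl | rfl | rfl | rfl | rfl | rfl <;> dsimp at e2 ⊢ <;>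
      split_ifs <;> omega
  -- the sum along the diagonal; the corner `(0, N)` of the triangle, where the secant vanishes,
  -- is bypassed by `(0, N - 1)`, `(1, N - 1)`, `(1, N)`
  have hdiag : ∑ i ∈ Finset.range (N - 1), (H i (i + 1) + V i (i + 2)) =
      V 0 (N - 1) + H 1 (N - 1) := by
    obtain ⟨k, rfl⟩ : ∃ k, N = k + 3 := ⟨N - 3, by omega⟩
    rw [show k + 3 - 1 = (k + 1) + 1 by omega, Finset.sum_range_succ']
    have h1 := triangle_sum H V (k + 1) 1 fun i j h1 h2 h3 => hsq i j h2 (by omega) (by omega)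
    have h2 : ∑ i ∈ Finset.range (k + 1), V (1 + i) (1 + (k + 1) + 1) = 0 :=
      Finset.sum_eq_zero fun i hi => by
        rw [Finset.mem_range] at hi
        rw [show 1 + (k + 1) + 1 = k + 3 by omega]
        exact hcol _ (by omega) (by omega)
    have h3 : ∀ l ≤ k, ∑ i ∈ Finset.range l, H 1 (1 + i + 1) = V 0 (l + 2) - V 0 2 := by
      intro l hl
      induction l with
      | zero => simp
      | succ l ih =>
        rw [Finset.sum_range_succ, ih (by omega)]
        have e1 := hsq 0 (l + 2) (by omega) (by omega) (by omega)
        rw [hrow (l + 2) (by omega) (by omega)] at e1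
        rw [show 1 + l + 1 = l + 2 by omega, show l + 1 + 2 = l + 2 + 1 by omega]
        simp only [zero_add] at e1
        linarith
    have h4 := h3 k le_rfl
    rw [h2, Finset.sum_range_succ (fun i => H 1 (1 + i + 1)), h4] at h1
    have h5 : ∑ i ∈ Finset.range (k + 1), (H (i + 1) (i + 1 + 1) + V (i + 1) (i + 1 + 2)) =
        ∑ i ∈ Finset.range (k + 1), (H (1 + i) (1 + i + 1) + V (1 + i) (1 + i + 2)) :=
      Finset.sum_congr rfl fun i _ => by rw [add_comm i 1]
    have h6 : H 0 (0 + 1) = 0 := hrow (0 + 1) (by omega) (by omega)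
    rw [h5, h1, h6, show 1 + k + 1 = k + 2 by omega, show k + 1 + 1 = k + 2 by omega]
    ring
  -- twice the turning is eight times the number of crossings with the ray
  have hturn : 2 * ∑ i ∈ Finset.range N, cross (d i) (d (i + 1)) =
      8 * ∑ i ∈ Finset.range N, (H i (i + 1) + V i (i + 2)) := by
    have h1 : ∑ i ∈ Finset.range N, cross (d (i + 1)) (d (i + 1 + 1)) =
        ∑ i ∈ Finset.range N, cross (d i) (d (i + 1)) := by
      have e1 := Finset.sum_range_succ (fun i => cross (d i) (d (i + 1))) N
      have e2 := Finset.sum_range_succ' (fun i => cross (d i) (d (i + 1))) N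
      have e3 : cross (d N) (d (N + 1)) = cross (d 0) (d (0 + 1)) := by
        have := hd 0
        have h' := hd 1
        rw [zero_add] at this
        rw [add_comm 1 N] at h'
        rw [this, h']
      rw [e3] at e1
      linarith
    have h2 : ∑ i ∈ Finset.range N, (octant (a (i + 1)) - octant (a i)) = 0 := by
      rw [Finset.sum_range_sub (fun i => octant (a i))]
      have := haN 0
      rw [zero_add] at this
      rw [this, sub_self]
    rw [two_mul]
    nth_rewrite 2 [← h1]
    rw [← Finset.sum_add_distrib, Finset.mul_sum, ← zero_add (∑ i ∈ Finset.range N, 8 * _), ← h2,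
      ← Finset.sum_add_distrib]
    refine Finset.sum_congr rfl fun i _ => ?_
    rw [turn_eq_octant (hdir i) (hdir (i + 1)) (hdir (i + 1 + 1)) (hne i) (hne (i + 1))]
    simp only [hH, hV]
    rw [show p (i + 1) - p i = a i by rw [hpa]; abel,
      show p (i + 1 + 1) - p i = a i + a (i + 1) by rw [hpa, hpa]; abel,
      show p (i + 2) - p (i + 1) = a (i + 1) by rw [hpa]; abel]
  have hlast : ∑ i ∈ Finset.range N, (H i (i + 1) + V i (i + 2)) =
      V 0 (N - 1) + H 1 (N - 1) + (H (N - 1) N + V (N - 1) (N + 1)) := by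
    obtain ⟨k, rfl⟩ : ∃ k, N = k + 1 := ⟨N - 1, by omega⟩
    rw [Finset.sum_range_succ]
    rw [show k + 1 - 1 = k by omega] at hdiag ⊢
    rw [hdiag]
  have hprev : p N = p (N - 1) + a (N - 1) := by
    have := hpa (N - 1)
    rwa [show N - 1 + 1 = N by omega] at this
  have hb : a (N - 1) = -(p (N - 1) - p 0) := by
    rw [← hpN, hprev]; abel
  have ha0 : a 0 = p 1 - p 0 := by
    have := hpa 0
    rw [zero_add] at this
    rw [this]; abel
  have hext := rayCross_extremal (hstepA 0) (hstepA (N - 1))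
    (by
      have := hmin 1 (by omega) (by omega)
      rw [ha0]; simp only [Prod.fst_sub, Prod.snd_sub]; omega)
    (by
      have := hmin (N - 1) (by omega) (by omega)
      rw [hb]; simp only [Prod.fst_sub, Prod.snd_sub, Prod.fst_neg, Prod.snd_neg]; omega)
    (by
      have := hinj 1 (N - 1) (by omega) (by omega)
      rw [ha0, hb]
      intro h
      apply this
      rw [← sub_eq_zero, ← h]; abel)
  have hfin : V 0 (N - 1) + H 1 (N - 1) + (H (N - 1) N + V (N - 1) (N + 1)) =
      rayCross (a (N - 1)) (a (N - 1) + a 0) + rayCross (a (N - 1) + a 0) (a 0) +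
      (rayCross (-a (N - 1)) (-a (N - 1) - a 0) + rayCross (-a (N - 1) - a 0) (-a 0)) := by
    simp only [hH, hV]
    rw [show N - 1 + 1 = N by omega, hpN1, hpN, hb, ha0, zero_add]
    rw [show p 1 - p (N - 1) = -(p (N - 1) - p 0) + (p 1 - p 0) by abel,
      show p 0 - p (N - 1) = -(p (N - 1) - p 0) by abel,
      show p (N - 1) - p 1 = -(-(p (N - 1) - p 0)) - (p 1 - p 0) by abel,
      show p 0 - p 1 = -(p 1 - p 0) by abel]
    rw [neg_neg]
    ring
  rw [hlast, hfin] at hturn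
  rcases hext with h | h <;> rw [h] at hturn
  · left; linarith
  · right; linarith

end LatticeCurve

/-! ### Edges meeting at a lattice point -/

namespace GridDiagram

variable {n : ℕ} {D : GridDiagram n}

/-- A common point of a vertical and a horizontal segment which is interior to one of them is a
crossing. -/
theorem exists_crossing {c r : Fin n} (h1 : D.bot c ≤ r ∧ r ≤ D.top c)
    (h2 : D.left r ≤ c ∧ c ≤ D.right r)
    (h : (D.bot c < r ∧ r < D.top c) ∨ (D.left r < c ∧ c < D.right r)) :
    ∃ x : D.Crossing, x.1 = (c, r) := by
  have h3 := D.corner_iff c r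
  refine ⟨⟨(c, r), ?_⟩, rfl⟩
  simp only [Fin.ext_iff, Fin.lt_def, Fin.le_def] at *
  omega

namespace Edge

theorem lo_ne_hi (e : D.Edge) : e.lo ≠ e.hi := by
  rcases e with ⟨⟨c, k⟩, h⟩ | ⟨⟨k, r⟩, h⟩ <;> simp [lo, hi]

theorem eq_of_lo {e f : D.Edge} (h : e.isLeft = f.isLeft) (h' : e.lo = f.lo) : e = f := by
  rcases e with ⟨⟨c, k⟩, h1⟩ | ⟨⟨k, r⟩, h1⟩ <;> rcases f with ⟨⟨c', k'⟩, h2⟩ | ⟨⟨k', r'⟩, h2⟩ <;>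
    simp [lo] at h h' ⊢ <;> omega

theorem eq_of_hi {e f : D.Edge} (h : e.isLeft = f.isLeft) (h' : e.hi = f.hi) : e = f := by
  rcases e with ⟨⟨c, k⟩, h1⟩ | ⟨⟨k, r⟩, h1⟩ <;> rcases f with ⟨⟨c', k'⟩, h2⟩ | ⟨⟨k', r'⟩, h2⟩ <;>
    simp [hi] at h h' ⊢ <;> omega

/-- Twice the midpoint of an edge. -/
def mid (e : D.Edge) : ℤ × ℤ := e.lo + e.hi

theorem mid_injective : Function.Injective (mid : D.Edge → ℤ × ℤ) := by
  intro e f h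
  rcases e with ⟨⟨c, k⟩, h1⟩ | ⟨⟨k, r⟩, h1⟩ <;> rcases f with ⟨⟨c', k'⟩, h2⟩ | ⟨⟨k', r'⟩, h2⟩ <;>
    simp [mid, lo, hi] at h ⊢ <;> omega

theorem mid_odd (e : D.Edge) : (e.mid.1 + e.mid.2) % 2 = 1 := by
  rcases e with ⟨⟨c, k⟩, h1⟩ | ⟨⟨k, r⟩, h1⟩ <;> simp [mid, lo, hi] <;> omega

theorem isLeft_of_hi_sub_lo {e f : D.Edge}
    (h : e.hi - e.lo = f.hi - f.lo ∨ e.hi - e.lo = -(f.hi - f.lo)) : e.isLeft = f.isLeft := by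
  rcases e with ⟨⟨c, k⟩, h1⟩ | ⟨⟨k, r⟩, h1⟩ <;> rcases f with ⟨⟨c', k'⟩, h2⟩ | ⟨⟨k', r'⟩, h2⟩ <;>
    simp [lo, hi] at h ⊢

/-- A lattice point incident to two vertical and one horizontal edges, or vice versa, is a
crossing. -/
theorem exists_crossing_of_three {v : ℤ × ℤ} {e f g : D.Edge} (he : e.lo = v ∨ e.hi = v)
    (hf : f.lo = v ∨ f.hi = v) (hg : g.lo = v ∨ g.hi = v) (hne : e ≠ f)
    (h1 : e.isLeft = f.isLeft) (h2 : g.isLeft ≠ e.isLeft) : ∃ x : D.Crossing, x.pt = v := by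
  have key : ∀ c r : Fin n, v = (((c : ℕ) : ℤ), ((r : ℕ) : ℤ)) → D.bot c ≤ r → r ≤ D.top c →
      D.left r ≤ c → c ≤ D.right r →
      ((D.bot c < r ∧ r < D.top c) ∨ (D.left r < c ∧ c < D.right r)) →
      ∃ x : D.Crossing, x.pt = v := by
    intro c r hv a1 a2 a3 a4 a5
    obtain ⟨x, hx⟩ := exists_crossing ⟨a1, a2⟩ ⟨a3, a4⟩ a5
    exact ⟨x, by rw [Crossing.pt, hx, hv]⟩
  rcases e with ⟨⟨c, k⟩, he'⟩ | ⟨⟨k, r⟩, he'⟩ <;> rcases f with ⟨⟨c', k'⟩, hf'⟩ | ⟨⟨k', r'⟩, hf'⟩ <;>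
    rcases g with ⟨⟨c₁, k₁⟩, hg'⟩ | ⟨⟨k₁, r₁⟩, hg'⟩ <;> simp at h1 h2 <;> clear h1 h2
  · obtain ⟨v1, v2⟩ := v
    simp only [lo, hi, Prod.mk.injEq] at he hf hg
    obtain rfl : c = c' := by ext; omega
    have hv : v1 = ((c : ℕ) : ℤ) ∧ v2 = ((r₁ : ℕ) : ℤ) := by omega
    obtain ⟨rfl, rfl⟩ := hv
    simp only [ne_eq, Sum.inl.injEq, Subtype.mk.injEq, Prod.mk.injEq, true_and] at hne
    refine key c r₁ rfl ?_ ?_ ?_ ?_ (Or.inl ⟨?_, ?_⟩) <;>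
      simp only [Fin.ext_iff, Fin.lt_def, Fin.le_def] at * <;> omega
  · obtain ⟨v1, v2⟩ := v
    simp only [lo, hi, Prod.mk.injEq] at he hf hg
    obtain rfl : r = r' := by ext; omega
    have hv : v1 = ((c₁ : ℕ) : ℤ) ∧ v2 = ((r : ℕ) : ℤ) := by omega
    obtain ⟨rfl, rfl⟩ := hv
    simp only [ne_eq, Sum.inr.injEq, Subtype.mk.injEq, Prod.mk.injEq, and_true] at hne
    refine key c₁ r rfl ?_ ?_ ?_ ?_ (Or.inr ⟨?_, ?_⟩) <;>
      simp only [Fin.ext_iff, Fin.lt_def, Fin.le_def] at * <;> omega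

end Edge

theorem JoinedAt.symm {s : D.Crossing → Bool} {v : ℤ × ℤ} {e f : D.Edge}
    (h : D.JoinedAt s v e f) : D.JoinedAt s v f e :=
  ⟨h.1.symm, h.2.2.1, h.2.1, fun x hx =>
    ⟨(h.2.2.2 x hx).1.symm, (h.2.2.2 x hx).2.trans ⟨Iff.symm, Iff.symm⟩⟩⟩

/-- At each of its ends an edge is followed by at most one edge. -/
theorem JoinedAt.unique {s : D.Crossing → Bool} {v : ℤ × ℤ} {e f g : D.Edge}
    (hf : D.JoinedAt s v e f) (hg : D.JoinedAt s v e g) : f = g := by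
  obtain ⟨f1, f2, f3, f4⟩ := hf
  obtain ⟨g1, -, g3, g4⟩ := hg
  by_contra hne
  by_cases hx : ∃ x : D.Crossing, x.pt = v
  · obtain ⟨x, hx⟩ := hx
    obtain ⟨a1, a2⟩ := f4 x hx
    obtain ⟨b1, b2⟩ := g4 x hx
    have h1 : f.isLeft = g.isLeft := by
      revert a1 b1
      cases e.isLeft <;> cases f.isLeft <;> cases g.isLeft <;> simp
    have h2 : f.lo = v ↔ g.lo = v := by tauto
    by_cases h3 : f.lo = v
    · exact hne (Edge.eq_of_lo h1 (h3.trans (h2.1 h3).symm))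
    · exact hne (Edge.eq_of_hi h1 ((f3.resolve_left h3).trans
        (g3.resolve_left (fun h => h3 (h2.2 h))).symm))
  · by_cases h1 : f.isLeft = g.isLeft
    · by_cases h2 : e.isLeft = f.isLeft
      · -- two of three distinct parallel edges would have the same end at `v`
        have aux : ∀ a b : D.Edge, a ≠ b → a.isLeft = b.isLeft → a.lo = v → b.lo ≠ v :=
          fun a b hab h h' h'' => hab (Edge.eq_of_lo h (h'.trans h''.symm))
        have aux' : ∀ a b : D.Edge, a ≠ b → a.isLeft = b.isLeft → a.hi = v → b.hi ≠ v :=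
          fun a b hab h h' h'' => hab (Edge.eq_of_hi h (h'.trans h''.symm))
        have := aux e f f1 h2
        have := aux e g g1 (h2.trans h1)
        have := aux f g hne h1
        have := aux' e f f1 h2
        have := aux' e g g1 (h2.trans h1)
        have := aux' f g hne h1
        tauto
      · exact hx (Edge.exists_crossing_of_three f3 g3 f2 hne h1 h2)
    · by_cases h2 : e.isLeft = f.isLeft
      · exact hx (Edge.exists_crossing_of_three f2 f3 g3 f1 h2
          fun h => h1 (h2.symm.trans h.symm))
      · have h3 : e.isLeft = g.isLeft := by
          revert h1 h2
          cases e.isLeft <;> cases f.isLeft <;> cases g.isLeft <;> simp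
        exact hx (Edge.exists_crossing_of_three f2 g3 f3 g1 h3 (Ne.symm h2))

/-- A horizontal edge at a point of a horizontal segment, on the prescribed side. -/
theorem exists_horizontal {c r : Fin n} (b : Bool)
    (h : if b then D.left r ≤ c ∧ c < D.right r else D.left r < c ∧ c ≤ D.right r) :
    ∃ p, (Edge.lo (Sum.inr p : D.Edge) = (((c : ℕ) : ℤ), ((r : ℕ) : ℤ)) ∧ b = true) ∨
      (Edge.hi (Sum.inr p : D.Edge) = (((c : ℕ) : ℤ), ((r : ℕ) : ℤ)) ∧ b = false) := by
  cases b
  · simp only [Bool.false_eq_true, if_false] at h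
    refine ⟨⟨(⟨c - 1, by omega⟩, r), ?_⟩, Or.inr ⟨?_, rfl⟩⟩
    · simp only [Fin.lt_def, Fin.le_def] at *
      omega
    · simp only [Edge.hi, Prod.mk.injEq, and_true]
      have := Fin.lt_def.1 h.1
      omega
  · simp only [if_true] at h
    exact ⟨⟨(c, r), h⟩, Or.inl ⟨rfl, rfl⟩⟩

/-- A vertical edge at a point of a vertical segment, on the prescribed side. -/
theorem exists_vertical {c r : Fin n} (b : Bool)
    (h : if b then D.bot c ≤ r ∧ r < D.top c else D.bot c < r ∧ r ≤ D.top c) :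
    ∃ p, (Edge.lo (Sum.inl p : D.Edge) = (((c : ℕ) : ℤ), ((r : ℕ) : ℤ)) ∧ b = true) ∨
      (Edge.hi (Sum.inl p : D.Edge) = (((c : ℕ) : ℤ), ((r : ℕ) : ℤ)) ∧ b = false) := by
  cases b
  · simp only [Bool.false_eq_true, if_false] at h
    refine ⟨⟨(c, ⟨r - 1, by omega⟩), ?_⟩, Or.inr ⟨?_, rfl⟩⟩
    · simp only [Fin.lt_def, Fin.le_def] at *
      omega
    · simp only [Edge.hi, Prod.mk.injEq, true_and]
      have := Fin.lt_def.1 h.1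
      omega
  · simp only [if_true] at h
    exact ⟨⟨(c, r), h⟩, Or.inl ⟨rfl, rfl⟩⟩

theorem Crossing.eq_of_pt {x : D.Crossing} {c r : Fin n}
    (h : x.pt = (((c : ℕ) : ℤ), ((r : ℕ) : ℤ))) : x.1 = (c, r) := by
  obtain ⟨⟨c', r'⟩, h'⟩ := x
  simp only [Crossing.pt, Prod.mk.injEq, Nat.cast_inj, Fin.val_inj] at h
  simp [h]

theorem exists_joinedAt_vertical (s : D.Crossing → Bool) {v : ℤ × ℤ} {p}
    (he : Edge.lo (Sum.inl p : D.Edge) = v ∨ Edge.hi (Sum.inl p : D.Edge) = v) :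
    ∃ f, D.JoinedAt s v (Sum.inl p) f := by
  -- is `v` the lower or left end of the edge?
  obtain ⟨b, hb⟩ : ∃ b : Bool, b = true ↔ Edge.lo (Sum.inl p : D.Edge) = v :=
    ⟨decide _, decide_eq_true_iff⟩
  have hlo := Edge.lo_ne_hi (Sum.inl p : D.Edge)
  have hlr := D.left_lt_right
  have hbt := D.bot_lt_top
  obtain ⟨⟨c, k⟩, h⟩ := p
  obtain ⟨r, hv, h1⟩ : ∃ r : Fin n, v = (((c : ℕ) : ℤ), ((r : ℕ) : ℤ)) ∧
      ((r : ℕ) = k ∧ b = true ∨ (r : ℕ) = k + 1 ∧ b = false) := by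
    rcases he with he | he
    · exact ⟨k, he.symm, Or.inl ⟨rfl, hb.2 he⟩⟩
    · refine ⟨⟨k + 1, ?_⟩, by rw [← he]; simp [Edge.hi], Or.inr ⟨rfl, ?_⟩⟩
      · have := Fin.lt_def.1 h.2
        simp only at this
        omega
      · rw [Bool.eq_false_iff, Ne, hb]
        rintro rfl
        exact hlo he.symm
  have hr : D.bot c ≤ r ∧ r ≤ D.top c := by
    dsimp only at h
    simp only [Fin.ext_iff, Fin.lt_def, Fin.le_def] at *
    omega
  have hc := D.corner_iff c r
  by_cases hx : D.left r ≤ c ∧ c ≤ D.right r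
  · -- a corner or a crossing: the next edge is horizontal
    have : ∃ b' : Bool, (if b' then D.left r ≤ c ∧ c < D.right r else
        D.left r < c ∧ c ≤ D.right r) ∧
        ∀ x : D.Crossing, x.pt = v → (s x = false ↔ b' = b) := by
      by_cases h2 : c = D.left r ∨ c = D.right r
      · have h4 := hlr r
        refine ⟨decide (c = D.left r), ?_, ?_⟩
        · rcases h2 with h2 | h2
          · simp [← h2] at h4 ⊢
            exact h4
          · simp only [← h2] at h4 ⊢
            simp [h4, h4.ne']
        · intro x hx
          rw [hv] at hx
          have h3 := x.2
          rw [Crossing.eq_of_pt hx] at h3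
          rcases h2 with h2 | h2 <;> simp [h2] at h3
      · push Not at h2
        have h3 : D.left r < c ∧ c < D.right r :=
          ⟨lt_of_le_of_ne hx.1 h2.1.symm, lt_of_le_of_ne hx.2 h2.2⟩
        obtain ⟨x, hx'⟩ := exists_crossing hr hx (Or.inr h3)
        refine ⟨if s x then !b else b, ?_, fun y hy => ?_⟩
        · split_ifs <;> exact ⟨by first | exact h3.1 | exact h3.1.le,
            by first | exact h3.2 | exact h3.2.le⟩
        · rw [hv] at hy
          rw [show y = x from Subtype.ext ((Crossing.eq_of_pt hy).trans hx'.symm)]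
          cases s x <;> cases b <;> simp
    obtain ⟨b', hb', hs⟩ := this
    obtain ⟨p, hp⟩ := exists_horizontal b' hb'
    rw [← hv] at hp
    have hlo' := Edge.lo_ne_hi (Sum.inr p : D.Edge)
    refine ⟨Sum.inr p, by simp, he, by tauto, fun x hx => ⟨by simp, ?_⟩⟩
    rw [hs x hx, ← hb]
    have : Edge.lo (Sum.inr p : D.Edge) = v ↔ b' = true := by
      rcases hp with ⟨hp, rfl⟩ | ⟨hp, rfl⟩
      · simp [hp]
      · simp only [Bool.false_eq_true, iff_false]
        exact fun h => hlo' (h.trans hp.symm)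
    rw [this]
    cases b <;> cases b' <;> simp
  · have h2 : r ≠ D.bot c ∧ r ≠ D.top c := by
      rw [← not_or, hc]
      have := hlr r
      rintro (h' | h')
      · exact hx ⟨h'.ge, h' ▸ this.le⟩
      · exact hx ⟨h' ▸ this.le, h'.le⟩
    obtain ⟨p, hp⟩ := exists_vertical (D := D) (c := c) (r := r) (!b) (by
      dsimp only at h
      simp only [Fin.lt_def, Fin.le_def] at *
      split_ifs <;> omega)
    rw [← hv] at hp
    refine ⟨Sum.inl p, ?_, he, by tauto, fun x hx' => ?_⟩
    · intro heq
      rw [← heq] at hp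
      rcases hp with ⟨hp, hp'⟩ | ⟨hp, hp'⟩
      · rw [hb.2 hp] at hp'
        simp at hp'
      · have hbt : b = true := by simpa using hp'
        exact hlo ((hb.1 hbt).trans hp.symm)
    · rw [hv] at hx'
      have h3 := x.2
      rw [Crossing.eq_of_pt hx'] at h3
      exact absurd ⟨h3.2.1.le, h3.2.2.le⟩ hx

theorem exists_joinedAt_horizontal (s : D.Crossing → Bool) {v : ℤ × ℤ} {p}
    (he : Edge.lo (Sum.inr p : D.Edge) = v ∨ Edge.hi (Sum.inr p : D.Edge) = v) :
    ∃ f, D.JoinedAt s v (Sum.inr p) f := by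
  -- is `v` the lower or left end of the edge?
  obtain ⟨b, hb⟩ : ∃ b : Bool, b = true ↔ Edge.lo (Sum.inr p : D.Edge) = v :=
    ⟨decide _, decide_eq_true_iff⟩
  have hlo := Edge.lo_ne_hi (Sum.inr p : D.Edge)
  have hlr := D.left_lt_right
  have hbt := D.bot_lt_top
  obtain ⟨⟨k, r⟩, h⟩ := p
  obtain ⟨c, hv, h1⟩ : ∃ c : Fin n, v = (((c : ℕ) : ℤ), ((r : ℕ) : ℤ)) ∧
      ((c : ℕ) = k ∧ b = true ∨ (c : ℕ) = k + 1 ∧ b = false) := by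
    rcases he with he | he
    · exact ⟨k, he.symm, Or.inl ⟨rfl, hb.2 he⟩⟩
    · refine ⟨⟨k + 1, ?_⟩, by rw [← he]; simp [Edge.hi], Or.inr ⟨rfl, ?_⟩⟩
      · have := Fin.lt_def.1 h.2
        simp only at this
        omega
      · rw [Bool.eq_false_iff, Ne, hb]
        rintro rfl
        exact hlo he.symm
  have hx : D.left r ≤ c ∧ c ≤ D.right r := by
    dsimp only at h
    simp only [Fin.ext_iff, Fin.lt_def, Fin.le_def] at *
    omega
  have hc := D.corner_iff c r
  by_cases hr : D.bot c ≤ r ∧ r ≤ D.top c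
  · have : ∃ b' : Bool, (if b' then D.bot c ≤ r ∧ r < D.top c else
        D.bot c < r ∧ r ≤ D.top c) ∧
        ∀ x : D.Crossing, x.pt = v → (s x = false ↔ b' = b) := by
      by_cases h2 : r = D.bot c ∨ r = D.top c
      · have h4 := hbt c
        refine ⟨decide (r = D.bot c), ?_, ?_⟩
        · rcases h2 with h2 | h2
          · simp [← h2] at h4 ⊢
            exact h4
          · simp only [← h2] at h4 ⊢
            simp [h4, h4.ne']
        · intro x hx
          rw [hv] at hx
          have h3 := x.2
          rw [Crossing.eq_of_pt hx] at h3
          rcases h2 with h2 | h2 <;> simp [h2] at h3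
      · push Not at h2
        have h3 : D.bot c < r ∧ r < D.top c :=
          ⟨lt_of_le_of_ne hr.1 h2.1.symm, lt_of_le_of_ne hr.2 h2.2⟩
        obtain ⟨x, hx'⟩ := exists_crossing hr hx (Or.inl h3)
        refine ⟨if s x then !b else b, ?_, fun y hy => ?_⟩
        · split_ifs <;> exact ⟨by first | exact h3.1 | exact h3.1.le,
            by first | exact h3.2 | exact h3.2.le⟩
        · rw [hv] at hy
          rw [show y = x from Subtype.ext ((Crossing.eq_of_pt hy).trans hx'.symm)]
          cases s x <;> cases b <;> simp
    obtain ⟨b', hb', hs⟩ := this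
    obtain ⟨p, hp⟩ := exists_vertical b' hb'
    rw [← hv] at hp
    have hlo' := Edge.lo_ne_hi (Sum.inl p : D.Edge)
    refine ⟨Sum.inl p, by simp, he, by tauto, fun x hx => ⟨by simp, ?_⟩⟩
    rw [hs x hx, ← hb]
    have : Edge.lo (Sum.inl p : D.Edge) = v ↔ b' = true := by
      rcases hp with ⟨hp, rfl⟩ | ⟨hp, rfl⟩
      · simp [hp]
      · simp only [Bool.false_eq_true, iff_false]
        exact fun h => hlo' (h.trans hp.symm)
    rw [this]
    cases b <;> cases b' <;> simp
  · have h2 : c ≠ D.left r ∧ c ≠ D.right r := by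
      rw [← not_or, ← hc]
      have := hbt c
      rintro (h' | h')
      · exact hr ⟨h'.ge, h' ▸ this.le⟩
      · exact hr ⟨h' ▸ this.le, h'.le⟩
    obtain ⟨p, hp⟩ := exists_horizontal (D := D) (c := c) (r := r) (!b) (by
      dsimp only at h
      simp only [Fin.lt_def, Fin.le_def] at *
      split_ifs <;> omega)
    rw [← hv] at hp
    refine ⟨Sum.inr p, ?_, he, by tauto, fun x hx' => ?_⟩
    · intro heq
      rw [← heq] at hp
      rcases hp with ⟨hp, hp'⟩ | ⟨hp, hp'⟩
      · rw [hb.2 hp] at hp'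
        simp at hp'
      · have hbt : b = true := by simpa using hp'
        exact hlo ((hb.1 hbt).trans hp.symm)
    · rw [hv] at hx'
      have h3 := x.2
      rw [Crossing.eq_of_pt hx'] at h3
      exact absurd ⟨h3.1.1.le, h3.1.2.le⟩ hr

/-- At each of its ends an edge is followed by some edge. -/
theorem exists_joinedAt (s : D.Crossing → Bool) {v : ℤ × ℤ} {e : D.Edge}
    (he : e.lo = v ∨ e.hi = v) : ∃ f, D.JoinedAt s v e f := by
  rcases e with p | p
  · exact exists_joinedAt_vertical s he
  · exact exists_joinedAt_horizontal s he

end GridDiagram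

/-! ### The circles of a Kauffman state and their rotation numbers -/

namespace GridDiagram

open LatticeCurve

variable {n : ℕ} {D : GridDiagram n}

namespace KauffmanState

variable (S : D.KauffmanState)

theorem head_eq_or (e : D.Edge) : e.lo = e.head S.orient ∨ e.hi = e.head S.orient := by
  unfold Edge.head
  split_ifs <;> simp

theorem head_or_tail {e : D.Edge} {v : ℤ × ℤ} (h : e.lo = v ∨ e.hi = v) :
    e.head S.orient = v ∨ e.tail S.orient = v := by
  unfold Edge.head Edge.tail
  split_ifs <;> tauto

theorem head_add_tail (e : D.Edge) : e.head S.orient + e.tail S.orient = e.mid := by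
  unfold Edge.head Edge.tail Edge.mid
  split_ifs <;> abel

/-- The edge following the edge `e` on its oriented circle, as a function. -/
noncomputable def succ (e : D.Edge) : D.Edge :=
  (exists_joinedAt S.smoothing (S.head_eq_or e)).choose

theorem joinedAt_succ (e : D.Edge) : D.JoinedAt S.smoothing (e.head S.orient) e (S.succ e) :=
  (exists_joinedAt S.smoothing (S.head_eq_or e)).choose_spec

theorem tail_succ (e : D.Edge) : (S.succ e).tail S.orient = e.head S.orient :=
  (S.coherent _ _ _ (S.joinedAt_succ e)).1 rfl

theorem succ_injective : Function.Injective S.succ := by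
  intro e f h
  have h1 := (S.joinedAt_succ e).symm
  have h2 := (S.joinedAt_succ f).symm
  rw [← S.tail_succ] at h1 h2
  rw [h] at h1
  exact h1.unique h2

/-- The permutation of the edges that takes each edge to the one following it on its oriented
circle. -/
noncomputable def next : Equiv.Perm D.Edge :=
  Equiv.ofBijective S.succ (Finite.injective_iff_bijective.1 S.succ_injective)

theorem joinedAt_next (e : D.Edge) : D.JoinedAt S.smoothing (e.head S.orient) e (S.next e) :=
  S.joinedAt_succ e

theorem tail_next (e : D.Edge) : (S.next e).tail S.orient = e.head S.orient := S.tail_succ e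

theorem next_eq {e f : D.Edge} (h : D.JoinedAt S.smoothing (e.head S.orient) e f) :
    S.next e = f := (S.joinedAt_next e).unique h

theorem next_ne (e : D.Edge) : S.next e ≠ e := (S.joinedAt_next e).1.symm

theorem adj_iff (e f : D.Edge) :
    (D.resolutionGraph S.smoothing).Adj e f ↔ S.next e = f ∨ S.next f = e := by
  constructor
  · rintro ⟨v, h⟩
    rcases S.head_or_tail h.2.1 with hv | hv
    · exact Or.inl (S.next_eq (hv ▸ h))
    · have := (S.coherent _ _ _ h.symm).2 hv
      exact Or.inr (S.next_eq (this ▸ h.symm))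
  · rintro (rfl | rfl)
    · exact ⟨_, S.joinedAt_next e⟩
    · exact ⟨_, (S.joinedAt_next f).symm⟩

/-- The circles are the cycles of the permutation `next`. -/
theorem connectedComponentMk_eq_iff (e f : D.Edge) :
    (D.resolutionGraph S.smoothing).connectedComponentMk e =
      (D.resolutionGraph S.smoothing).connectedComponentMk f ↔ S.next.SameCycle e f := by
  rw [SimpleGraph.ConnectedComponent.eq]
  constructor
  · rintro ⟨w⟩
    induction w with
    | nil => exact Equiv.Perm.SameCycle.refl _ _
    | cons h _ ih =>
      refine Equiv.Perm.SameCycle.trans ?_ ih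
      rcases (S.adj_iff _ _).1 h with h | h
      · exact ⟨1, by simpa using h⟩
      · exact ⟨-1, by rw [zpow_neg_one, Equiv.Perm.inv_eq_iff_eq]; exact h.symm⟩
  · intro h
    obtain ⟨k, hk⟩ := h.exists_nat_pow_eq
    rw [← hk]
    clear hk
    induction k with
    | zero => simp
    | succ k ih =>
      refine ih.trans (SimpleGraph.Adj.reachable ?_)
      rw [S.adj_iff, pow_succ', Equiv.Perm.mul_apply]
      exact Or.inl rfl

theorem isUnitDir_dir (e : D.Edge) : IsUnitDir (S.dir e) := by
  rcases e with ⟨⟨c, k⟩, h⟩ | ⟨⟨k, r⟩, h⟩ <;> unfold dir Edge.head Edge.tail <;> split_ifs <;>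
    simp [Edge.lo, Edge.hi, IsUnitDir]

/-- In doubled coordinates, half an edge from the midpoint leads to the end. -/
theorem mid_add_dir (e : D.Edge) : e.mid + S.dir e = e.head S.orient + e.head S.orient := by
  rw [← S.head_add_tail, dir]
  abel

theorem mid_next (e : D.Edge) : (S.next e).mid = e.mid + (S.dir e + S.dir (S.next e)) := by
  rw [← add_assoc, S.mid_add_dir, ← S.head_add_tail (S.next e), dir, S.tail_next]
  abel

theorem dir_next_ne (e : D.Edge) : S.dir (S.next e) ≠ -S.dir e := by
  intro h
  have := S.mid_next e
  rw [h, add_neg_cancel, add_zero] at this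
  exact S.next_ne e (Edge.mid_injective this)

theorem isLeft_eq_of_dir {e f : D.Edge} (h : S.dir e = S.dir f ∨ S.dir e = -S.dir f) :
    e.isLeft = f.isLeft := by
  apply Edge.isLeft_of_hi_sub_lo
  unfold dir Edge.head Edge.tail at h
  have h1 : ∀ a b c d : ℤ × ℤ, (a - b = c - d ∨ a - b = -(c - d)) →
      (a - b = c - d ∨ a - b = -(c - d)) ∧ (b - a = c - d ∨ b - a = -(c - d)) := by
    intro a b c d h
    refine ⟨h, ?_⟩
    rcases h with h | h
    · exact Or.inr (by rw [← h]; abel)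
    · exact Or.inl (by rw [← neg_sub, h]; abel)
  split_ifs at h
  · exact h
  · have := h1 _ _ _ _ h
    rw [← neg_sub e.hi, neg_inj, ← neg_sub f.hi, neg_neg] at this
    exact this.1.symm
  · exact (h1 _ _ _ _ h).2
  · have := h1 _ _ _ _ h
    rw [← neg_sub f.hi, neg_neg] at this
    exact this.2.symm

theorem isLeft_eq_iff_dir (e f : D.Edge) :
    e.isLeft = f.isLeft ↔ S.dir e = S.dir f ∨ S.dir e = -S.dir f := by
  refine ⟨fun h => ?_, S.isLeft_eq_of_dir⟩
  rcases e with ⟨⟨c, k⟩, h1⟩ | ⟨⟨k, r⟩, h1⟩ <;> rcases f with ⟨⟨c', k'⟩, h2⟩ | ⟨⟨k', r'⟩, h2⟩ <;>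
    simp at h <;> unfold dir Edge.head Edge.tail <;> split_ifs <;> simp [Edge.lo, Edge.hi]

theorem turning_eq_sum (C : D.Circle S.smoothing) [DecidablePred fun e =>
    (D.resolutionGraph S.smoothing).connectedComponentMk e = C] :
    S.turning C = ∑ e with (D.resolutionGraph S.smoothing).connectedComponentMk e = C,
      cross (S.dir e) (S.dir (S.next e)) := by
  classical
  rw [turning, Finset.sum_filter]
  refine Finset.sum_congr rfl fun e _ => ?_
  rw [Finset.sum_eq_single (S.next e)]
  · by_cases h : (D.resolutionGraph S.smoothing).connectedComponentMk e = C
    · rw [if_pos ⟨h, S.joinedAt_next e⟩, if_pos h, cross]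
    · rw [if_neg (fun h' => h h'.1), if_neg h]
  · intro f _ hf
    rw [if_neg]
    exact fun h => hf (S.next_eq h.2).symm
  · simp

/-- The circles of a Kauffman state are simple closed curves, once the crossings are smoothed, so
the tangent makes exactly one turn. -/
theorem turning_eq (C : D.Circle S.smoothing) : S.turning C = 4 ∨ S.turning C = -4 := by
  classical
  set A : Finset D.Edge := Finset.univ.filter fun e =>
    (D.resolutionGraph S.smoothing).connectedComponentMk e = C with hA
  have hAne : A.Nonempty := by
    obtain ⟨e, he⟩ := C.exists_rep
    exact ⟨e, Finset.mem_filter.2 ⟨Finset.mem_univ _, he⟩⟩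
  -- start at the lowest and then leftmost edge
  obtain ⟨e, heA, hmin⟩ := A.exists_min_image (fun e => toLex (e.mid.2, e.mid.1)) hAne
  have heC : (D.resolutionGraph S.smoothing).connectedComponentMk e = C :=
    (Finset.mem_filter.1 heA).2
  set u : ℕ → D.Edge := fun i => (S.next)^[i] e with hu
  have hu0 : u 0 = e := rfl
  have hus : ∀ i, u (i + 1) = S.next (u i) := fun i => Function.iterate_succ_apply' _ _ _
  have huA : ∀ i, u i ∈ A := by
    intro i
    rw [hA, Finset.mem_filter, ← heC]
    refine ⟨Finset.mem_univ _, ?_⟩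
    rw [eq_comm, S.connectedComponentMk_eq_iff]
    exact ⟨i, by rw [zpow_natCast, ← Equiv.Perm.iterate_eq_pow]⟩
  set N := Function.minimalPeriod S.next e with hN
  have hNpos : 0 < N :=
    Function.minimalPeriod_pos_of_mem_periodicPts
      (Function.Injective.mem_periodicPts S.next.injective e)
  have hper : ∀ i, u (i + N) = u i := fun i => Function.iterate_add_minimalPeriod_eq
  have hinj : ∀ i j, i < j → j < N → u i ≠ u j := by
    intro i j hij hj h
    have := Function.iterate_injOn_Iio_minimalPeriod (f := S.next) (x := e)
      (Set.mem_Iio.2 (hij.trans hj)) (Set.mem_Iio.2 hj) h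
    omega
  have hAimg : A = (Finset.range N).image u := by
    ext f
    rw [Finset.mem_image]
    constructor
    · intro hf
      have hf' : (D.resolutionGraph S.smoothing).connectedComponentMk e =
          (D.resolutionGraph S.smoothing).connectedComponentMk f := by
        rw [heC]
        exact (Finset.mem_filter.1 hf).2.symm
      obtain ⟨k, hk⟩ := ((S.connectedComponentMk_eq_iff e f).1 hf').exists_nat_pow_eq
      refine ⟨k % N, Finset.mem_range.2 (Nat.mod_lt _ hNpos), ?_⟩
      rw [hu]
      simp only
      rw [Function.iterate_mod_minimalPeriod_eq, Equiv.Perm.iterate_eq_pow, hk]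
    · rintro ⟨i, -, rfl⟩
      exact huA i
  have hsum : S.turning C =
      ∑ i ∈ Finset.range N, cross (S.dir (u i)) (S.dir (u (i + 1))) := by
    rw [turning_eq_sum, ← hA, hAimg, Finset.sum_image]
    · exact Finset.sum_congr rfl fun i _ => by rw [hus]
    · intro i hi j hj h
      rw [Finset.mem_coe, Finset.mem_range] at hi hj
      by_contra hne
      rcases lt_or_gt_of_ne hne with h' | h'
      · exact hinj i j h' hj h
      · exact hinj j i h' hi h.symm
  have hstep : ∀ i, (u (i + 1)).mid = (u i).mid + (S.dir (u i) + S.dir (u (i + 1))) := fun i => by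
    rw [hus, S.mid_next]
  have hN3 : 3 ≤ N := by
    by_contra hlt
    obtain h1 | h2 : N = 1 ∨ N = 2 := by omega
    · have := hper 0
      rw [h1, hus] at this
      exact S.next_ne _ this
    · -- a closed curve of two steps would go back and forth
      have h3 := hper 0
      have h4 := hstep 0
      have h5 := hstep 1
      rw [h2] at h3
      simp only [zero_add, Nat.reduceAdd] at h3 h4 h5
      have h6 := S.dir_next_ne (u 0)
      rw [← hus] at h6
      rw [h3, h4] at h5
      have e1 := congrArg Prod.fst h5
      have e2 := congrArg Prod.snd h5
      simp only [Prod.fst_add, Prod.snd_add] at e1 e2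
      apply h6
      ext
      · rw [zero_add, Prod.fst_neg]; linarith
      · rw [zero_add, Prod.snd_neg]; linarith
  rw [hsum]
  refine turning_of_simple_closed (p := fun i => (u i).mid) hN3 (fun i => by simp only [hper])
    (fun i => by simp only [hper]) hstep (fun i => S.isUnitDir_dir _)
    (fun i => by rw [hus]; exact S.dir_next_ne _) (fun i => Edge.mid_odd _)
    (fun i j h1 h2 h => hinj i j h1 h2 (Edge.mid_injective h)) ?_ ?_
  · -- two perpendicular straight steps with a common centre would meet at a crossing, but there
    -- the edges following each other are perpendicular
    intro i j h1 h2 h3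
    by_contra hcon
    have h4 : (u j).isLeft ≠ (u i).isLeft := fun h => hcon ((S.isLeft_eq_iff_dir _ _).1 h)
    rw [hus] at h1
    have h5 := S.isLeft_eq_of_dir (Or.inl h1)
    have h6 : (u i).head S.orient = (u j).head S.orient := by
      rw [S.mid_add_dir, S.mid_add_dir] at h3
      have e1 := congrArg Prod.fst h3
      have e2 := congrArg Prod.snd h3
      simp only [Prod.fst_add, Prod.snd_add] at e1 e2
      ext
      · linarith
      · linarith
    have h7 := S.joinedAt_next (u i)
    obtain ⟨x, hx⟩ := Edge.exists_crossing_of_three h7.2.1 h7.2.2.1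
      (h6 ▸ S.head_eq_or (u j)) h7.1 h5.symm h4
    exact (h7.2.2.2 x hx).1 h5.symm
  · intro i hi hiN
    have h1 := hmin (u i) (huA i)
    have h2 : e.mid ≠ (u i).mid := fun h => hinj 0 i hi hiN (Edge.mid_injective h)
    simp only [hu0]
    rw [Prod.Lex.toLex_le_toLex] at h1
    simp only at h1
    rw [Ne, Prod.ext_iff] at h2
    omega

/-- The rotation number, counted locally: four times the number of counterclockwise minus the
number of clockwise circles is the total number of left minus right quarter turns. -/
theorem four_mul_rot : 4 * S.rot = ∑ e, cross (S.dir e) (S.dir (S.next e)) := by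
  classical
  rw [rot, Finset.mul_sum]
  have h1 : ∀ C : D.Circle S.smoothing,
      4 * (if S.IsCounterclockwise C then 1 else -1 : ℤ) = S.turning C := by
    intro C
    unfold IsCounterclockwise
    rcases S.turning_eq C with h | h <;> rw [h] <;> simp
  rw [Finset.sum_congr rfl fun C _ => (by convert h1 C :
    4 * (if S.IsCounterclockwise C then 1 else -1 : ℤ) = S.turning C)]
  simp only [turning_eq_sum]
  exact Finset.sum_fiberwise _ _ _

end KauffmanState

end GridDiagram

/-! ### The rotation number as a sum over the columns -/

namespace GridDiagram

open LatticeCurve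

variable {n : ℕ} {D : GridDiagram n}

/-- `1` at a corner which is the right end of its row, `-1` at one which is the left end. -/
def cornerSign (D : GridDiagram n) (c r : Fin n) : ℤ := if c = D.right r then 1 else -1

open Classical in
/-- `1` at a `1`-smoothing, `-1` at a `0`-smoothing, and `0` at points which are no crossings. -/
noncomputable def smoothingSign (s : D.Crossing → Bool) (c r : Fin n) : ℤ :=
  if h : (D.bot c < r ∧ r < D.top c) ∧ (D.left r < c ∧ c < D.right r) then
    if s ⟨(c, r), h⟩ then 1 else -1 else 0

theorem smoothingSign_of_crossing (s : D.Crossing → Bool) (x : D.Crossing) :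
    smoothingSign s x.1.1 x.1.2 = if s x then 1 else -1 := by
  rw [smoothingSign, dif_pos x.2]

theorem smoothingSign_of_not {s : D.Crossing → Bool} {c r : Fin n}
    (h : ¬ ((D.bot c < r ∧ r < D.top c) ∧ (D.left r < c ∧ c < D.right r))) :
    smoothingSign s c r = 0 := by
  rw [smoothingSign, dif_neg h]

namespace KauffmanState

variable (S : D.KauffmanState)

/-- The quarter turn at an end `v` of an edge. -/
noncomputable def turnAt (e : D.Edge) (v : ℤ × ℤ) : ℤ :=
  if e.head S.orient = v then cross (S.dir e) (S.dir (S.next e))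
  else cross (S.dir (S.next.symm e)) (S.dir e)

theorem dir_vertical (p) :
    S.dir (Sum.inl p) = (0, if S.orient (Sum.inl p) then 1 else -1) := by
  unfold dir Edge.head Edge.tail
  split_ifs <;> simp [Edge.lo, Edge.hi]

theorem dir_horizontal (p) :
    S.dir (Sum.inr p) = (if S.orient (Sum.inr p) then 1 else -1, 0) := by
  unfold dir Edge.head Edge.tail
  split_ifs <;> simp [Edge.lo, Edge.hi]

/-- The turn from a vertical edge to its neighbour `f` at `v`: it depends on the orientation of the
vertical edge and on whether `f` lies to the right or to the left of `v`. -/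
theorem turnAt_eq {p} {f : D.Edge} {v : ℤ × ℤ} (h : D.JoinedAt S.smoothing v (Sum.inl p) f) :
    S.turnAt (Sum.inl p) v = if f.isLeft then 0 else
      (if S.orient (Sum.inl p) then 1 else -1) * (if f.lo = v then -1 else 1) := by
  have hlo := f.lo_ne_hi
  unfold turnAt
  by_cases h1 : Edge.head S.orient (Sum.inl p) = v
  · rw [if_pos h1]
    have h2 := S.next_eq (h1.symm ▸ h)
    have h3 := (S.coherent _ _ _ h).1 h1
    rw [h2]
    rcases f with q | q
    · simp [dir_vertical, cross]
    · rw [dir_vertical, dir_horizontal, cross]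
      unfold Edge.tail at h3
      split_ifs at h3 with h4
      · simp [h4, h3]
      · have h5 : Edge.lo (Sum.inr q : D.Edge) ≠ v := fun h => hlo (h.trans h3.symm)
        simp [h4, h5]
  · rw [if_neg h1]
    have h3 : f.head S.orient = v := by
      by_contra h3
      exact h1 ((S.coherent _ _ _ h).2
        ((S.head_or_tail h.2.2.1).resolve_left h3))
    have h2 : S.next.symm (Sum.inl p) = f := by
      rw [Equiv.symm_apply_eq]
      exact (S.next_eq (h3.symm ▸ h.symm)).symm
    rw [h2]
    rcases f with q | q
    · simp [dir_vertical, cross]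
    · rw [dir_vertical, dir_horizontal, cross]
      unfold Edge.head at h3
      split_ifs at h3 with h4
      · have h5 : Edge.lo (Sum.inr q : D.Edge) ≠ v := fun h => hlo (h.trans h3.symm)
        simp [h4, h5]
      · simp only [h4, h3]
        simp
        split_ifs <;> rfl

/-- Every quarter turn of the circles takes place at an end of a vertical edge. -/
theorem sum_cross_eq : ∑ e, cross (S.dir e) (S.dir (S.next e)) =
    ∑ p, (S.turnAt (Sum.inl p) (Edge.lo (Sum.inl p)) +
      S.turnAt (Sum.inl p) (Edge.hi (Sum.inl p))) := by
  -- attribute each turn to its vertical edge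
  have h1 : ∀ e : D.Edge, cross (S.dir e) (S.dir (S.next e)) =
      (if e.isLeft then cross (S.dir e) (S.dir (S.next e)) else 0) +
      (if (S.next e).isLeft then cross (S.dir (S.next.symm (S.next e))) (S.dir (S.next e))
        else 0) := by
    intro e
    rw [Equiv.symm_apply_apply]
    generalize S.next e = f
    rcases e with p | p <;> rcases f with q | q <;>
      simp only [dir_vertical, dir_horizontal, cross, Sum.isLeft_inl, Sum.isLeft_inr, if_true,
        Bool.false_eq_true, if_false] <;> ring
  have h2 : ∀ p, cross (S.dir (Sum.inl p)) (S.dir (S.next (Sum.inl p))) +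
      cross (S.dir (S.next.symm (Sum.inl p))) (S.dir (Sum.inl p)) =
      S.turnAt (Sum.inl p) (Edge.lo (Sum.inl p)) + S.turnAt (Sum.inl p) (Edge.hi (Sum.inl p)) := by
    intro p
    have := Edge.lo_ne_hi (Sum.inl p : D.Edge)
    unfold turnAt Edge.head
    generalize cross (S.dir (Sum.inl p)) (S.dir (S.next (Sum.inl p))) = a
    generalize cross (S.dir (S.next.symm (Sum.inl p))) (S.dir (Sum.inl p)) = b
    by_cases h : S.orient (Sum.inl p) = true
    · rw [if_pos h, if_neg this.symm, if_pos rfl, add_comm]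
    · rw [if_neg h, if_pos rfl, if_neg this]
  rw [Finset.sum_congr rfl fun e _ => h1 e, Finset.sum_add_distrib,
    Equiv.sum_comp S.next fun f =>
      if f.isLeft then cross (S.dir (S.next.symm f)) (S.dir f) else 0,
    Fintype.sum_sum_type, Fintype.sum_sum_type, ← Finset.sum_congr rfl fun p _ => h2 p,
    Finset.sum_add_distrib]
  simp only [Sum.isLeft_inl, if_true, Sum.isLeft_inr, Bool.false_eq_true, if_false, add_zero,
    Finset.sum_const_zero]

/-- The quarter turn at an end `(c, r)` of a vertical edge in column `c`: the lower end if `b` is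
`true`, the upper end otherwise. -/
theorem turnAt_vertical {c k r : Fin n} (hp : D.bot c ≤ k ∧ k < D.top c) (b : Bool)
    (hb : b = true ∧ r = k ∨ b = false ∧ (r : ℕ) = k + 1) :
    S.turnAt (Sum.inl ⟨(c, k), hp⟩) (((c : ℕ) : ℤ), ((r : ℕ) : ℤ)) =
      (if S.orient (Sum.inl ⟨(c, k), hp⟩) then 1 else -1) *
        ((if r = D.bot c ∨ r = D.top c then D.cornerSign c r else 0) +
          (if b then 1 else -1) * smoothingSign S.smoothing c r) := by
  have hlo : Edge.lo (Sum.inl ⟨(c, k), hp⟩ : D.Edge) = (((c : ℕ) : ℤ), ((r : ℕ) : ℤ)) ↔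
      b = true := by
    simp only [Edge.lo, Prod.mk.injEq, true_and]
    rcases hb with ⟨rfl, rfl⟩ | ⟨rfl, h⟩
    · simp
    · simp; omega
  have hend : Edge.lo (Sum.inl ⟨(c, k), hp⟩ : D.Edge) = (((c : ℕ) : ℤ), ((r : ℕ) : ℤ)) ∨
      Edge.hi (Sum.inl ⟨(c, k), hp⟩ : D.Edge) = (((c : ℕ) : ℤ), ((r : ℕ) : ℤ)) := by
    rw [hlo]
    rcases hb with ⟨rfl, rfl⟩ | ⟨rfl, h⟩
    · simp
    · simp [Edge.hi]; omega
  obtain ⟨f, hf⟩ := exists_joinedAt S.smoothing hend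
  rw [S.turnAt_eq hf]
  obtain ⟨f1, -, f3, f4⟩ := hf
  have hr : D.bot c ≤ r ∧ r ≤ D.top c := by
    simp only [Fin.ext_iff, Fin.lt_def, Fin.le_def] at *
    omega
  have hcor := D.corner_iff c r
  have hbt := D.bot_lt_top c
  by_cases hx : (D.bot c < r ∧ r < D.top c) ∧ (D.left r < c ∧ c < D.right r)
  · -- at a crossing the neighbour is determined by the smoothing
    obtain ⟨h1, h2⟩ := f4 ⟨(c, r), hx⟩ rfl
    rw [smoothingSign, dif_pos hx, if_neg (show ¬ (r = D.bot c ∨ r = D.top c) by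
      rintro (h | h) <;> simp [← h] at hx)]
    rw [hlo] at h2
    rcases f with q | q
    · simp at h1
    · simp only [Sum.isLeft_inr, Bool.false_eq_true, if_false, zero_add]
      congr 1
      by_cases h3 : Edge.lo (Sum.inr q : D.Edge) = (((c : ℕ) : ℤ), ((r : ℕ) : ℤ))
      · cases b <;> simp [h3] at h2 ⊢ <;> simp [h2]
      · cases b <;> simp [h3] at h2 ⊢ <;> simp [h2]
  · rw [smoothingSign_of_not hx, mul_zero, add_zero]
    rcases f with ⟨⟨c', k'⟩, hq⟩ | ⟨⟨k', r'⟩, hq⟩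
    · -- the segment passes straight through `(c, r)`
      rw [if_neg (show ¬ (r = D.bot c ∨ r = D.top c) by
        simp only [Edge.lo, Edge.hi, Prod.mk.injEq] at f3
        obtain rfl : c' = c := by ext; omega
        have hne : k ≠ k' := fun h => f1 (by simp [h])
        clear f4 hlo hend hx hcor
        dsimp only at hq
        simp only [Fin.ext_iff, Fin.lt_def, Fin.le_def, ne_eq] at *
        omega)]
      simp
    · -- at a corner the neighbour lies in the interior of its row
      simp only [Edge.lo, Edge.hi, Prod.mk.injEq] at f3
      obtain rfl : r' = r := by ext; omega
      clear f4 hlo hend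
      dsimp only at hq
      have hc : c = D.left r' ∨ c = D.right r' := by
        simp only [Fin.ext_iff, Fin.lt_def, Fin.le_def] at *
        omega
      rw [if_pos (hcor.2 hc)]
      simp only [Sum.isLeft_inr, Bool.false_eq_true, if_false, Edge.lo, cornerSign,
        Prod.mk.injEq, and_true]
      congr 1
      have : ((k' : ℕ) : ℤ) = ((c : ℕ) : ℤ) ↔ ¬ c = D.right r' := by
        simp only [Fin.ext_iff, Fin.lt_def, Fin.le_def] at *
        omega
      simp only [this]
      split_ifs <;> rfl

/-- The rotation number of a state whose edges point away from the points `(c, row c)` on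
vertical segments and towards them on horizontal segments. -/
theorem four_mul_rot_of_orient (row : Equiv.Perm (Fin n)) (hS : S.orient = D.orientOf row)
    (hV : ∀ c, D.bot c ≤ row c ∧ row c ≤ D.top c) :
    4 * S.rot = ∑ c, (D.cornerSign c (D.bot c) * (if row c = D.bot c then 1 else -1) +
      D.cornerSign c (D.top c) * (if row c = D.top c then -1 else 1) +
      2 * smoothingSign S.smoothing c (row c)) := by
  rw [four_mul_rot, sum_cross_eq, Finset.sum_add_distrib]
  -- the lower ends of the vertical edges
  have h1 : ∑ p, S.turnAt (Sum.inl p) (Edge.lo (Sum.inl p)) = ∑ c, ∑ r,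
      if D.bot c ≤ r ∧ r < D.top c then (if row c ≤ r then 1 else -1) *
        ((if r = D.bot c ∨ r = D.top c then D.cornerSign c r else 0) +
          smoothingSign S.smoothing c r) else 0 := by
    rw [← Fintype.sum_prod_type', ← Finset.sum_filter]
    rw [Finset.sum_subtype (p := fun p : Fin n × Fin n =>
      D.bot p.1 ≤ p.2 ∧ p.2 < D.top p.1) (Finset.univ.filter _) (by simp)]
    refine Finset.sum_congr rfl ?_
    rintro ⟨⟨c, k⟩, hp⟩ -
    rw [show Edge.lo (Sum.inl ⟨(c, k), hp⟩ : D.Edge) = (((c : ℕ) : ℤ), ((k : ℕ) : ℤ)) from rfl,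
      S.turnAt_vertical hp true (Or.inl ⟨rfl, rfl⟩), hS]
    simp [orientOf]
  -- the upper ends of the vertical edges
  have h2 : ∑ p, S.turnAt (Sum.inl p) (Edge.hi (Sum.inl p)) = ∑ c, ∑ r,
      if D.bot c < r ∧ r ≤ D.top c then (if row c < r then 1 else -1) *
        ((if r = D.bot c ∨ r = D.top c then D.cornerSign c r else 0) -
          smoothingSign S.smoothing c r) else 0 := by
    rw [← Fintype.sum_prod_type', ← Finset.sum_filter]
    have hlt : ∀ p : {p : Fin n × Fin n // D.bot p.1 ≤ p.2 ∧ p.2 < D.top p.1},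
        (p.1.2 : ℕ) + 1 < n := fun p => by
      have := Fin.lt_def.1 p.2.2
      omega
    refine Finset.sum_bij (fun p _ => (p.1.1, ⟨p.1.2 + 1, hlt p⟩)) ?_ ?_ ?_ ?_
    · rintro ⟨⟨c, k⟩, hp⟩ -
      simp only [Finset.mem_filter, Finset.mem_univ, true_and]
      dsimp only at hp
      simp only [Fin.lt_def, Fin.le_def] at *
      omega
    · rintro ⟨⟨c, k⟩, hp⟩ - ⟨⟨c', k'⟩, hp'⟩ - h
      simp only [Prod.mk.injEq, Fin.mk.injEq, add_left_inj, Fin.val_inj] at h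
      simp [h]
    · rintro ⟨c, r⟩ h
      simp only [Finset.mem_filter, Finset.mem_univ, true_and] at h
      have := Fin.lt_def.1 h.1
      refine ⟨⟨(c, ⟨r - 1, by omega⟩), ?_⟩, Finset.mem_univ _, ?_⟩
      · simp only [Fin.lt_def, Fin.le_def] at *
        omega
      · simp only [Prod.mk.injEq, true_and, Fin.ext_iff]
        omega
    · rintro ⟨⟨c, k⟩, hp⟩ -
      have h := S.turnAt_vertical hp (r := ⟨k + 1, hlt ⟨(c, k), hp⟩⟩) false (Or.inr ⟨rfl, rfl⟩)
      rw [show Edge.hi (Sum.inl ⟨(c, k), hp⟩ : D.Edge) =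
        (((c : ℕ) : ℤ), (((⟨k + 1, hlt ⟨(c, k), hp⟩⟩ : Fin n) : ℕ) : ℤ)) by simp [Edge.hi], h, hS]
      simp only [orientOf, Bool.false_eq_true, if_false, decide_eq_true_eq, Fin.lt_def, Fin.le_def,
        Nat.lt_succ_iff]
      ring
  rw [h1, h2, ← Finset.sum_add_distrib]
  refine Finset.sum_congr rfl fun c _ => ?_
  rw [← Finset.sum_add_distrib]
  have hbt := D.bot_lt_top c
  -- at interior points the two contributions cancel, except where the orientation changes
  have h3 : ∀ r, ((if D.bot c ≤ r ∧ r < D.top c then (if row c ≤ r then 1 else -1) *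
        ((if r = D.bot c ∨ r = D.top c then D.cornerSign c r else 0) +
          smoothingSign S.smoothing c r) else 0) +
      if D.bot c < r ∧ r ≤ D.top c then (if row c < r then 1 else -1) *
        ((if r = D.bot c ∨ r = D.top c then D.cornerSign c r else 0) -
          smoothingSign S.smoothing c r) else 0 : ℤ) =
      (if r = D.bot c then D.cornerSign c r * (if row c = r then 1 else -1) else 0) +
      (if r = D.top c then D.cornerSign c r * (if row c = r then -1 else 1) else 0) +
      (if r = row c then 2 * smoothingSign S.smoothing c r else 0) := by
    intro r
    have hv := hV c
    by_cases hr : D.bot c < r ∧ r < D.top c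
    · simp only [hr.1.le, hr.2, hr.1, hr.2.le, hr.1.ne', hr.2.ne, and_self, or_self, if_true,
        if_false]
      rcases lt_trichotomy (row c) r with h | h | h
      · simp only [h.le, h, h.ne', if_true, if_false]; ring
      · simp only [h, le_refl, lt_irrefl, if_true, if_false]; ring
      · simp only [not_le.2 h, not_lt.2 h.le, h.ne, if_false]; ring
    · rw [smoothingSign_of_not (fun h => hr h.1)]
      by_cases hb : r = D.bot c
      · simp only [hb, le_refl, lt_irrefl, hbt, hbt.ne, true_or, false_and, and_self, if_true,
          if_false]
        rcases hv.1.lt_or_eq with h | h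
        · simp only [not_le.2 h, h.ne', if_false]; simp
        · simp only [← h, le_refl, if_true]; simp
      · by_cases ht : r = D.top c
        · simp only [ht, le_refl, lt_irrefl, hbt, hbt.ne', or_true, and_false, and_self, if_true,
            if_false]
          rcases hv.2.lt_or_eq with h | h
          · simp only [h, h.ne, if_true, if_false]; simp
          · simp only [h, lt_irrefl, if_true, if_false]; simp
        · have h4 : ¬ (D.bot c ≤ r ∧ r < D.top c) :=
            fun h => hr ⟨lt_of_le_of_ne h.1 (Ne.symm hb), h.2⟩
          have h5 : ¬ (D.bot c < r ∧ r ≤ D.top c) := fun h => hr ⟨h.1, lt_of_le_of_ne h.2 ht⟩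
          rw [if_neg h4, if_neg h5, if_neg hb, if_neg ht]
          simp
  rw [Finset.sum_congr rfl fun r _ => h3 r, Finset.sum_add_distrib, Finset.sum_add_distrib,
    Finset.sum_ite_eq' Finset.univ (D.bot c), Finset.sum_ite_eq' Finset.univ (D.top c),
    Finset.sum_ite_eq' Finset.univ (row c)]
  simp

end KauffmanState
end GridDiagram

/-! ### Winding numbers of polygonal paths -/

/-- The argument of a quotient is the difference of the arguments up to the multiple of `2 * π` that
brings it between `-π` and `π`. -/
theorem Complex.arg_div_eq_of_lt {x y : ℂ} (hx : x ≠ 0) (hy : y ≠ 0) (k : ℤ)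
    (h1 : -Real.pi < y.arg - x.arg + 2 * Real.pi * k)
    (h2 : y.arg - x.arg + 2 * Real.pi * k < Real.pi) :
    (y / x).arg = y.arg - x.arg + 2 * Real.pi * k := by
  rw [← Complex.arg_coe_angle_toReal_eq_arg, Complex.arg_div_coe_angle hy hx,
    ← Real.Angle.coe_sub, ← (Real.Angle.toReal_coe_eq_self_iff.2 ⟨h1, h2.le⟩)]
  congr 1
  rw [Real.Angle.angle_eq_iff_two_pi_dvd_sub]
  refine ⟨-k, ?_⟩
  push_cast
  ring

/-- The angle of `z` seen from `p`, measured from the upward direction, with a jump at the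
downward vertical ray from `p`. -/
noncomputable def angleFrom (p z : ℂ) : ℝ := Complex.arg ⟨z.im - p.im, -(z.re - p.re)⟩

/-- The signed number of crossings of the segment from `a` to `b` with the downward vertical ray
from `p`, for segments in good position. -/
noncomputable def downCross (p a b : ℂ) : ℤ :=
  if a.im < p.im ∧ b.im < p.im then
    (if a.re < p.re then 1 else 0) - (if b.re < p.re then 1 else 0) else 0

/-- The segment from `a` to `b` lies above `p`, or on one side of `p`, or below `p` with no end on
the vertical line through `p`. -/
def GoodPosition (p a b : ℂ) : Prop :=
  (p.im < a.im ∧ p.im < b.im) ∨ (p.re < a.re ∧ p.re < b.re) ∨ (a.re < p.re ∧ b.re < p.re) ∨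
    (a.im < p.im ∧ b.im < p.im ∧ a.re ≠ p.re ∧ b.re ≠ p.re)

theorem GoodPosition.symm {p a b : ℂ} (h : GoodPosition p a b) : GoodPosition p b a := by
  unfold GoodPosition at *
  tauto

theorem downCross_symm (p a b : ℂ) : downCross p b a = -downCross p a b := by
  unfold downCross
  simp only [and_comm (a := b.im < p.im)]
  split_ifs <;> simp

theorem downCross_of_re_eq {p a b : ℂ} (h : a.re = b.re) : downCross p a b = 0 := by
  simp [downCross, h]

theorem downCross_of_le_im {p a b : ℂ} (h : p.im ≤ a.im ∨ p.im ≤ b.im) : downCross p a b = 0 := by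
  rw [downCross, if_neg]
  rw [not_and_or, not_lt, not_lt]
  exact h

theorem GoodPosition.downCross_eq_zero {p a b : ℂ}
    (h : (p.re < a.re ∧ p.re < b.re) ∨ (a.re < p.re ∧ b.re < p.re)) : downCross p a b = 0 := by
  rcases h with ⟨h1, h2⟩ | ⟨h1, h2⟩
  · simp [downCross, not_lt.2 h1.le, not_lt.2 h2.le]
  · simp [downCross, h1, h2]

/-- For a segment in good position the variation of the angle, which is less than half a turn, is
the difference of the angles of its ends, corrected at the jump. -/
theorem GoodPosition.arg_eq {p a b : ℂ} (h : GoodPosition p a b) :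
    Complex.arg ((b - p) / (a - p)) =
      angleFrom p b - angleFrom p a + 2 * Real.pi * downCross p a b := by
  -- a quarter turn, so that the jump of `arg` is at the downward ray
  have hw : ∀ z : ℂ, (⟨z.im - p.im, -(z.re - p.re)⟩ : ℂ) = -Complex.I * (z - p) := by
    intro z
    apply Complex.ext <;> simp
  have hq : (b - p) / (a - p) =
      (⟨b.im - p.im, -(b.re - p.re)⟩ : ℂ) / ⟨a.im - p.im, -(a.re - p.re)⟩ := by
    rw [hw, hw, mul_div_mul_left _ _ (neg_ne_zero.2 Complex.I_ne_zero)]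
  have hne : ∀ u v : ℝ, u ≠ 0 ∨ v ≠ 0 → (⟨u, v⟩ : ℂ) ≠ 0 := by
    intro u v huv h0
    rw [Complex.ext_iff] at h0
    simp at h0
    tauto
  have hpi := Real.pi_pos
  have hpos : ∀ u v : ℝ, 0 < v → 0 ≤ Complex.arg ⟨u, v⟩ ∧ Complex.arg ⟨u, v⟩ < Real.pi :=
    fun u v hv => ⟨Complex.arg_nonneg_iff.2 hv.le,
      lt_of_le_of_ne (Complex.arg_le_pi _) fun h => by
        rw [Complex.arg_eq_pi_iff] at h; exact hv.ne' h.2⟩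
  have hneg : ∀ u v : ℝ, v < 0 → -Real.pi < Complex.arg ⟨u, v⟩ ∧ Complex.arg ⟨u, v⟩ < 0 :=
    fun u v hv => ⟨Complex.neg_pi_lt_arg _, Complex.arg_neg_iff.2 hv⟩
  have hright : ∀ u v : ℝ, 0 < u → |Complex.arg ⟨u, v⟩| < Real.pi / 2 := fun u v hu =>
    Complex.abs_arg_lt_pi_div_two_iff.2 (Or.inl hu)
  have hleft : ∀ u v : ℝ, u < 0 → Real.pi / 2 < |Complex.arg ⟨u, v⟩| := fun u v hu => by
    rw [← not_le, Complex.abs_arg_le_pi_div_two_iff, not_le]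
    exact hu
  rw [hq]
  unfold angleFrom
  rcases h with ⟨h1, h2⟩ | ⟨h1, h2⟩ | ⟨h1, h2⟩ | ⟨h1, h2, h3, h4⟩
  · have e1 := abs_lt.1 (hright (a.im - p.im) (-(a.re - p.re)) (by linarith))
    have e2 := abs_lt.1 (hright (b.im - p.im) (-(b.re - p.re)) (by linarith))
    rw [show downCross p a b = 0 from if_neg fun h => absurd h.1 (not_lt.2 h1.le)]
    apply Complex.arg_div_eq_of_lt (hne _ _ (Or.inl (by linarith)))
      (hne _ _ (Or.inl (by linarith))) <;> push_cast <;> linarith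
  · have e1 := hneg (a.im - p.im) (-(a.re - p.re)) (by linarith)
    have e2 := hneg (b.im - p.im) (-(b.re - p.re)) (by linarith)
    rw [show downCross p a b = 0 by
      unfold downCross; rw [if_neg (not_lt.2 h1.le), if_neg (not_lt.2 h2.le)]; simp]
    apply Complex.arg_div_eq_of_lt (hne _ _ (Or.inr (by linarith)))
      (hne _ _ (Or.inr (by linarith))) <;> push_cast <;> linarith
  · have e1 := hpos (a.im - p.im) (-(a.re - p.re)) (by linarith)
    have e2 := hpos (b.im - p.im) (-(b.re - p.re)) (by linarith)
    rw [show downCross p a b = 0 by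
      unfold downCross; rw [if_pos h1, if_pos h2]; simp]
    apply Complex.arg_div_eq_of_lt (hne _ _ (Or.inr (by linarith)))
      (hne _ _ (Or.inr (by linarith))) <;> push_cast <;> linarith
  · have l1 := hleft (a.im - p.im) (-(a.re - p.re)) (by linarith)
    have l2 := hleft (b.im - p.im) (-(b.re - p.re)) (by linarith)
    have key : ∀ z : ℂ, z.re ≠ p.re → Real.pi / 2 < |Complex.arg ⟨z.im - p.im, -(z.re - p.re)⟩| →
        (z.re < p.re ∧ Real.pi / 2 < Complex.arg ⟨z.im - p.im, -(z.re - p.re)⟩ ∧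
          Complex.arg ⟨z.im - p.im, -(z.re - p.re)⟩ < Real.pi) ∨
        (¬ z.re < p.re ∧ -Real.pi < Complex.arg ⟨z.im - p.im, -(z.re - p.re)⟩ ∧
          Complex.arg ⟨z.im - p.im, -(z.re - p.re)⟩ < -(Real.pi / 2)) := by
      intro z hz hl
      rcases lt_or_gt_of_ne hz with h | h
      · have e := hpos (z.im - p.im) (-(z.re - p.re)) (by linarith)
        rw [abs_of_nonneg e.1] at hl
        exact Or.inl ⟨h, hl, e.2⟩
      · have e := hneg (z.im - p.im) (-(z.re - p.re)) (by linarith)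
        rw [abs_of_neg e.2] at hl
        exact Or.inr ⟨h.not_gt, e.1, by linarith⟩
    unfold downCross
    rw [if_pos ⟨h1, h2⟩]
    rcases key a h3 l1 with ⟨a1, a2, a3⟩ | ⟨a1, a2, a3⟩ <;>
      rcases key b h4 l2 with ⟨b1, b2, b3⟩ | ⟨b1, b2, b3⟩ <;>
      [rw [if_pos a1, if_pos b1]; rw [if_pos a1, if_neg b1]; rw [if_neg a1, if_pos b1];
        rw [if_neg a1, if_neg b1]] <;>
      apply Complex.arg_div_eq_of_lt (hne _ _ (Or.inl (by linarith)))
        (hne _ _ (Or.inl (by linarith))) <;> push_cast <;> linarith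

/-- `Turns p l a z k`: the polygonal path `l` leads from `a` to `z`, all its segments are in good
position with respect to `p`, and it crosses the downward ray from `p` with multiplicity `k`. -/
inductive Turns (p : ℂ) : List ℂ → ℂ → ℂ → ℤ → Prop
  | single (a : ℂ) : Turns p [a] a a 0
  | cons {a b z : ℂ} {l : List ℂ} {k : ℤ} (h : GoodPosition p a b) (h' : Turns p (b :: l) b z k) :
      Turns p (a :: b :: l) a z (downCross p a b + k)

namespace Turns

variable {p a z : ℂ} {l : List ℂ} {k : ℤ}

theorem angleAlong_eq (h : Turns p l a z k) :
    angleAlong p l = angleFrom p z - angleFrom p a + 2 * Real.pi * k := by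
  induction h with
  | single a => simp [angleAlong]
  | cons h _ ih =>
    rw [angleAlong] at ih ⊢
    rw [List.tail_cons, List.zip_cons_cons, List.map_cons, List.sum_cons]
    rw [List.tail_cons] at ih
    rw [ih, h.arg_eq]
    push_cast
    ring

theorem append {l' : List ℂ} {b : ℂ} {k' : ℤ} (h : Turns p l a z k)
    (h' : Turns p (z :: l') z b k') : Turns p (l ++ l') a b (k + k') := by
  induction h with
  | single a => simpa using h'
  | cons h _ ih =>
    rw [add_assoc]
    exact Turns.cons h (ih h')

theorem reverse (h : Turns p l a z k) : Turns p l.reverse z a (-k) := by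
  induction h with
  | single a => simpa using Turns.single a
  | @cons a b z l k h _ ih =>
    have h1 : Turns p [b, a] b a (downCross p b a + 0) := Turns.cons h.symm (Turns.single a)
    have := ih.append h1
    rw [List.reverse_cons]
    rwa [downCross_symm, add_zero, ← neg_add, add_comm k] at this

theorem eq_cons (h : Turns p l a z k) : l = a :: l.tail := by
  cases h <;> rfl

end Turns

/-! ### The gradings `T` and `Q` of a generator -/

/-- The number of pairs of columns `c < c'` with `α c < β c'`. -/
def Equiv.Perm.ascents {n : ℕ} (α β : Equiv.Perm (Fin n)) : ℤ :=
  ∑ c, ∑ c', if c < c' ∧ α c < β c' then 1 else 0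

namespace GridDiagram

variable {n : ℕ} {D : GridDiagram n}

namespace FigureEights
namespace Generator

variable {F : D.FigureEights} (g h : F.Generator)

/-- The lattice point `(c, r)` of the plane. -/
noncomputable def latticePt (c r : Fin n) : ℂ := ⟨(c : ℕ), (r : ℕ)⟩

/-- The point of `g` in column `c`, in coordinates. -/
theorem pt_re (c : Fin n) :
    (g.pt c).re = (c : ℕ) + (if g.side c then 1 / 4 else -(1 / 4) : ℝ) := by
  conv_lhs => rw [(g.spec c).1]
  rfl

theorem pt_im (c : Fin n) : (g.pt c).im = (g.row c : ℕ) := by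
  conv_lhs => rw [(g.spec c).1]
  rfl

theorem left_right_of_side (c : Fin n) :
    if g.side c then D.left (g.row c) ≤ c ∧ c < D.right (g.row c)
      else D.left (g.row c) < c ∧ c ≤ D.right (g.row c) := by
  obtain ⟨σ, h1, -, h3⟩ := (F.mem_interPoints _ _ _).1 (g.mem c)
  have : g.side c = σ := by
    rw [side, h1]
    cases σ <;> simp [sidePt]
  rwa [this]

/-- The signed number of crossings of the path `toTop` in column `c` with the downward ray from the
upper end of that column: there is one if the path passes through the self-intersection. -/
noncomputable def nodeCross (c : Fin n) : ℤ :=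
  if g.row c ≤ F.node c then (if g.side c then -1 else 1) else 0

/-- As seen from a puncture, the path from the point of `g` to the top of its figure-eight crosses
the downward ray only where it passes through the self-intersection, and only if the puncture is
the upper end of the same column. -/
theorem turns_toTop (c c₀ r₀ : Fin n) (hr : r₀ = D.bot c₀ ∨ r₀ = D.top c₀) :
    Turns (latticePt c₀ r₀) (g.toTop c) (g.pt c) ⟨(c : ℕ), (D.top c : ℕ) + 1 / 4⟩
      (if c = c₀ ∧ r₀ = D.top c then g.nodeCross c else 0) := by
  have hre := g.pt_re c
  have him := g.pt_im c
  have hV := (g.spec c).2.1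
  have hVb : ((D.bot c : ℕ) : ℝ) ≤ (g.row c : ℕ) := by exact_mod_cast hV.1
  have hVt : ((g.row c : ℕ) : ℝ) ≤ (D.top c : ℕ) := by exact_mod_cast hV.2
  have hmb : ((D.bot c : ℕ) : ℝ) ≤ (F.node c : ℕ) := by exact_mod_cast F.bot_le_node c
  have hmt : ((F.node c : ℕ) : ℝ) + 1 ≤ (D.top c : ℕ) := by exact_mod_cast F.node_lt_top c
  have hbt := D.bot_lt_top c
  have side_of_ne : c ≠ c₀ → ∀ a b : ℂ, |a.re - (c : ℕ)| ≤ 1 / 4 → |b.re - (c : ℕ)| ≤ 1 / 4 →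
      ((latticePt c₀ r₀).re < a.re ∧ (latticePt c₀ r₀).re < b.re) ∨
        (a.re < (latticePt c₀ r₀).re ∧ b.re < (latticePt c₀ r₀).re) := by
    intro hne a b ha hb
    rw [abs_le] at ha hb
    simp only [latticePt]
    rcases lt_or_gt_of_ne hne with h | h
    · have : ((c : ℕ) : ℝ) + 1 ≤ (c₀ : ℕ) := by exact_mod_cast h
      right; constructor <;> linarith
    · have : ((c₀ : ℕ) : ℝ) + 1 ≤ (c : ℕ) := by exact_mod_cast h
      left; constructor <;> linarith
  have hr₀ : ((r₀ : ℕ) : ℝ) ≤ (D.top c₀ : ℕ) := by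
    rcases hr with rfl | rfl
    · exact_mod_cast (D.bot_lt_top c₀).le
    · exact le_rfl
  -- a vertical segment next to the column
  have good_vert : ∀ a b : ℂ, a.re = b.re → |a.re - (c : ℕ)| = 1 / 4 →
      GoodPosition (latticePt c₀ r₀) a b := by
    intro a b hab ha
    by_cases hc : c = c₀
    · subst hc
      right
      rcases (abs_eq (by norm_num)).1 ha with h | h
      · left
        simp only [latticePt]
        constructor <;> linarith
      · right; left
        simp only [latticePt]
        constructor <;> linarith
    · rcases side_of_ne hc a b ha.le (hab ▸ ha.le) with h | h
      · exact Or.inr (Or.inl h)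
      · exact Or.inr (Or.inr (Or.inl h))
  -- the last segment, above the column
  have good_top : ∀ δ : ℝ, |δ| ≤ 1 / 4 → GoodPosition (latticePt c₀ r₀)
      ⟨(c : ℕ) + δ, (D.top c : ℕ) + 1 / 4⟩ ⟨(c : ℕ), (D.top c : ℕ) + 1 / 4⟩ := by
    intro δ hδ
    by_cases hc : c = c₀
    · subst hc
      left
      simp only [latticePt]
      constructor <;> linarith
    · rcases side_of_ne hc ⟨(c : ℕ) + δ, (D.top c : ℕ) + 1 / 4⟩
        ⟨(c : ℕ), (D.top c : ℕ) + 1 / 4⟩ (by simpa using hδ) (by simp) with h | h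
      · exact Or.inr (Or.inl h)
      · exact Or.inr (Or.inr (Or.inl h))
  have cross_top : ∀ δ : ℝ, |δ| ≤ 1 / 4 → downCross (latticePt c₀ r₀)
      ⟨(c : ℕ) + δ, (D.top c : ℕ) + 1 / 4⟩ ⟨(c : ℕ), (D.top c : ℕ) + 1 / 4⟩ = 0 := by
    intro δ hδ
    by_cases hc : c = c₀
    · subst hc
      refine downCross_of_le_im (Or.inl ?_)
      simp only [latticePt]
      linarith
    · exact GoodPosition.downCross_eq_zero (side_of_ne hc _ _ (by simpa using hδ) (by simp))
  obtain ⟨δ, hδ⟩ : ∃ δ : ℝ, δ = if g.side c then 1 / 4 else -(1 / 4) := ⟨_, rfl⟩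
  have hδ' : |δ| = 1 / 4 := by
    rw [hδ]; split_ifs
    · exact abs_of_pos (by norm_num)
    · rw [abs_neg]; exact abs_of_pos (by norm_num)
  have hδ'' : |(g.pt c).re - (c : ℕ)| = 1 / 4 := by rw [hre, ← hδ, add_sub_cancel_left, hδ']
  rw [← hδ] at hre
  unfold toTop
  simp only
  rw [← hδ]
  by_cases hm : g.row c ≤ F.node c
  · rw [if_pos hm]
    have hm' : ((g.row c : ℕ) : ℝ) ≤ (F.node c : ℕ) := by exact_mod_cast hm
    have good_node : GoodPosition (latticePt c₀ r₀) ⟨(c : ℕ) + δ, (F.node c : ℕ) + 1 / 4⟩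
        ⟨(c : ℕ) - δ, (F.node c : ℕ) + 3 / 4⟩ := by
      by_cases hc : c = c₀
      · subst hc
        rcases hr with rfl | rfl
        · left
          simp only [latticePt]
          constructor <;> linarith
        · right; right; right
          simp only [latticePt]
          have : δ ≠ 0 := fun h => by rw [h, abs_zero] at hδ'; norm_num at hδ'
          exact ⟨by linarith, by linarith, fun h => this (by linarith), fun h => this (by linarith)⟩
      · rcases side_of_ne hc ⟨(c : ℕ) + δ, (F.node c : ℕ) + 1 / 4⟩
          ⟨(c : ℕ) - δ, (F.node c : ℕ) + 3 / 4⟩ (by simpa using hδ'.le)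
          (by simpa [abs_neg] using hδ'.le) with h | h
        · exact Or.inr (Or.inl h)
        · exact Or.inr (Or.inr (Or.inl h))
    have cross_node : downCross (latticePt c₀ r₀) ⟨(c : ℕ) + δ, (F.node c : ℕ) + 1 / 4⟩
        ⟨(c : ℕ) - δ, (F.node c : ℕ) + 3 / 4⟩ =
        if c = c₀ ∧ r₀ = D.top c then g.nodeCross c else 0 := by
      by_cases hc : c = c₀
      · subst hc
        rcases hr with rfl | rfl
        · rw [if_neg (fun h => hbt.ne h.2)]
          refine downCross_of_le_im (Or.inl ?_)
          simp only [latticePt]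
          linarith
        · rw [if_pos ⟨rfl, rfl⟩, nodeCross, if_pos hm, downCross, if_pos (by
            simp only [latticePt]
            constructor <;> linarith)]
          simp only [latticePt]
          rw [hδ]
          cases g.side c <;> norm_num
      · rw [if_neg (fun h => hc h.1)]
        exact GoodPosition.downCross_eq_zero (side_of_ne hc _ _ (by simpa using hδ'.le)
          (by simpa [abs_neg] using hδ'.le))
    have h := Turns.cons (good_vert (g.pt c) ⟨(c : ℕ) + δ, (F.node c : ℕ) + 1 / 4⟩ hre hδ'')
      (Turns.cons good_node (Turns.cons
        (good_vert ⟨(c : ℕ) - δ, (F.node c : ℕ) + 3 / 4⟩ ⟨(c : ℕ) - δ, (D.top c : ℕ) + 1 / 4⟩ rfl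
          (by simpa [abs_neg] using hδ')) (Turns.cons
        (good_top (-δ) (by rw [abs_neg]; exact hδ'.le)) (Turns.single _))))
    have cross_top' := cross_top (-δ) (by rw [abs_neg]; exact hδ'.le)
    rw [← sub_eq_add_neg] at cross_top'
    rw [downCross_of_re_eq hre, cross_node, cross_top', downCross_of_re_eq
      (a := ⟨(c : ℕ) - δ, (F.node c : ℕ) + 3 / 4⟩) (b := ⟨(c : ℕ) - δ, (D.top c : ℕ) + 1 / 4⟩) rfl]
      at h
    simpa only [zero_add, add_zero] using h
  · rw [if_neg hm]
    have h := Turns.cons (good_vert (g.pt c) ⟨(c : ℕ) + δ, (D.top c : ℕ) + 1 / 4⟩ hre hδ'')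
      (Turns.cons (good_top δ hδ'.le) (Turns.single _))
    rw [downCross_of_re_eq hre, cross_top δ hδ'.le] at h
    rw [nodeCross, if_neg hm]
    simpa using h

/-- Indicator of the points to the lower left of `p`. -/
noncomputable def lowerLeft (p z : ℂ) : ℤ := if z.re < p.re ∧ z.im < p.im then 1 else 0

/-- The contribution of `g` to the winding numbers around the puncture `(c₀, r₀)` of the loops
starting at `g`. -/
noncomputable def level (c₀ r₀ : Fin n) : ℤ :=
  ∑ c, (lowerLeft (latticePt c₀ r₀) (g.pt c) -
    if c = c₀ ∧ r₀ = D.top c then g.nodeCross c else 0)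

/-- A horizontal piece of a loop does not run through a puncture, as its ends are at distance `1 / 4`
from the ends of the row at least. -/
theorem goodPosition_row {c c' c₀ r₀ : Fin n} (hr : r₀ = D.bot c₀ ∨ r₀ = D.top c₀)
    (hcc : g.row c = h.row c') : GoodPosition (latticePt c₀ r₀) (g.pt c) (h.pt c') := by
  have h1 := g.pt_re c
  have h2 := g.pt_im c
  have h3 := h.pt_re c'
  have h4 := h.pt_im c'
  rw [← hcc] at h4
  have ne : ∀ (d : Fin n) (b : Bool),
      ((d : ℕ) : ℝ) + (if b then 1 / 4 else -(1 / 4) : ℝ) ≠ (c₀ : ℕ) := by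
    intro d b hd
    rcases lt_trichotomy d c₀ with h | h | h
    · have : ((d : ℕ) : ℝ) + 1 ≤ (c₀ : ℕ) := by exact_mod_cast h
      cases b <;> simp at hd <;> linarith
    · subst h
      cases b <;> simp at hd
    · have : ((c₀ : ℕ) : ℝ) + 1 ≤ (d : ℕ) := by exact_mod_cast h
      cases b <;> simp at hd <;> linarith
  rcases lt_trichotomy (g.row c) r₀ with hlt | heq | hgt
  · have : ((g.row c : ℕ) : ℝ) < (r₀ : ℕ) := by exact_mod_cast hlt
    right; right; right
    simp only [latticePt]
    rw [h1, h2, h3, h4]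
    exact ⟨this, this, ne _ _, ne _ _⟩
  · have k1 := g.left_right_of_side c
    have k2 := h.left_right_of_side c'
    rw [← hcc] at k2
    rw [heq] at k1 k2
    have k3 := (D.corner_iff c₀ r₀).1 hr
    simp only [GoodPosition, latticePt]
    rw [h1, h3]
    right
    have cast : ∀ a b : Fin n, (a < b → ((a : ℕ) : ℝ) + 1 ≤ (b : ℕ)) ∧
        (a ≤ b → ((a : ℕ) : ℝ) ≤ (b : ℕ)) :=
      fun a b => ⟨fun h => by exact_mod_cast h, fun h => by exact_mod_cast h⟩
    rcases k3 with rfl | rfl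
    · left
      constructor
      · cases hs : g.side c <;>
          simp only [hs, Bool.false_eq_true, if_true, if_false] at k1 ⊢
        · linarith [(cast _ _).1 k1.1]
        · linarith [(cast _ _).2 k1.1]
      · cases hs : h.side c' <;>
          simp only [hs, Bool.false_eq_true, if_true, if_false] at k2 ⊢
        · linarith [(cast _ _).1 k2.1]
        · linarith [(cast _ _).2 k2.1]
    · right; left
      constructor
      · cases hs : g.side c <;>
          simp only [hs, Bool.false_eq_true, if_true, if_false] at k1 ⊢
        · linarith [(cast _ _).2 k1.2]
        · linarith [(cast _ _).1 k1.2]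
      · cases hs : h.side c' <;>
          simp only [hs, Bool.false_eq_true, if_true, if_false] at k2 ⊢
        · linarith [(cast _ _).2 k2.2]
        · linarith [(cast _ _).1 k2.2]
  · have : ((r₀ : ℕ) : ℝ) < (g.row c : ℕ) := by exact_mod_cast hgt
    left
    simp only [latticePt]
    rw [h2, h4]
    exact ⟨this, this⟩

theorem downCross_row {p : ℂ} {c c' : Fin n} (hcc : g.row c = h.row c') :
    downCross p (g.pt c) (h.pt c') = lowerLeft p (g.pt c) - lowerLeft p (h.pt c') := by
  have : (h.pt c').im = (g.pt c).im := by rw [pt_im, pt_im, hcc]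
  unfold downCross lowerLeft
  rw [this]
  by_cases h1 : (g.pt c).im < p.im <;> simp [h1]

/-- The winding number of a loop around a puncture is the difference of the levels of its ends. -/
theorem loopWinding_eq {c₀ r₀ : Fin n} (hr : r₀ = D.bot c₀ ∨ r₀ = D.top c₀) :
    g.loopWinding h (latticePt c₀ r₀) = ((g.level c₀ r₀ - h.level c₀ r₀ : ℤ) : ℝ) := by
  set p := latticePt c₀ r₀ with hp
  set τ : Equiv.Perm (Fin n) := g.row.trans h.row.symm with hτ
  have hrow : ∀ c, g.row c = h.row (τ c) := fun c => by simp [hτ]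
  set m : F.Generator → Fin n → ℤ :=
    fun g c => if c = c₀ ∧ r₀ = D.top c then g.nodeCross c else 0 with hm
  have hpath : ∀ c, angleAlong p (g.loopPath h c) =
      angleFrom p (g.pt (τ c)) - angleFrom p (g.pt c) + 2 * Real.pi *
        ((lowerLeft p (g.pt c) - lowerLeft p (h.pt (τ c)) + (m h (τ c) - m g (τ c)) : ℤ) : ℝ) := by
    intro c
    have h1 := h.turns_toTop (τ c) c₀ r₀ hr
    have h2 := (g.turns_toTop (τ c) c₀ r₀ hr).reverse
    rw [h2.eq_cons] at h2
    have h3 := h1.append h2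
    rw [h1.eq_cons, List.cons_append] at h3
    have h4 := (Turns.cons (g.goodPosition_row h hr (hrow c)) h3).angleAlong_eq
    rw [← List.cons_append, ← h1.eq_cons, downCross_row g h (hrow c)] at h4
    rw [show g.loopPath h c =
      g.pt c :: (h.toTop (τ c) ++ (g.toTop (τ c)).reverse.tail) from rfl, h4, ← sub_eq_add_neg]
  have hpi : (2 * Real.pi) ≠ 0 := by positivity
  rw [loopWinding, Finset.sum_congr rfl fun c _ => hpath c, Finset.sum_add_distrib,
    Finset.sum_sub_distrib, Equiv.sum_comp τ fun c => angleFrom p (g.pt c), sub_self, zero_add,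
    ← Finset.mul_sum, mul_div_cancel_left₀ _ hpi, ← Int.cast_sum]
  congr 1
  rw [Finset.sum_add_distrib, Finset.sum_sub_distrib, Finset.sum_sub_distrib,
    Equiv.sum_comp τ fun c => lowerLeft p (h.pt c), Equiv.sum_comp τ fun c => m h c,
    Equiv.sum_comp τ fun c => m g c]
  unfold level
  rw [Finset.sum_sub_distrib, Finset.sum_sub_distrib]
  ring

/-- The quarter by which the points are displaced does not affect their order. -/
theorem T_eq : (g.T : ℤ) = g.row.ascents g.row := by
  classical
  have hlt : ∀ c c', (g.pt c).im < (g.pt c').im ↔ g.row c < g.row c' := fun c c' => by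
    rw [pt_im, pt_im, Nat.cast_lt, Fin.lt_def]
  have hre : ∀ c c', c < c' → (g.pt c).re < (g.pt c').re := fun c c' hcc => by
    have : ((c : ℕ) : ℝ) + 1 ≤ (c' : ℕ) := by exact_mod_cast hcc
    rw [pt_re, pt_re]
    split_ifs <;> linarith
  have hre' : ∀ c c', (g.pt c).re < (g.pt c').re ↔ c < c' := by
    intro c c'
    refine ⟨fun h => ?_, hre c c'⟩
    by_contra hcc
    rcases (not_lt.1 hcc).lt_or_eq with h' | h'
    · exact lt_asymm h (hre _ _ h')
    · rw [h'] at h; exact lt_irrefl _ h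
  have hinj : Function.Injective g.pt := by
    intro c c' hcc
    rcases lt_trichotomy c c' with h | h | h
    · exact absurd (hre _ _ h) (by rw [hcc]; exact lt_irrefl _)
    · exact h
    · exact absurd (hre _ _ h) (by rw [hcc]; exact lt_irrefl _)
  have h1 : g.T = ((Finset.univ : Finset (Fin n × Fin n)).filter fun q =>
      q.1 < q.2 ∧ g.row q.1 < g.row q.2).card := by
    symm
    refine Finset.card_bij (fun q _ => (g.pt q.1, g.pt q.2)) ?_ ?_ ?_
    · rintro ⟨c, c'⟩ hq
      simp only [Finset.mem_filter, Finset.mem_univ, true_and] at hq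
      simp only [Finset.mem_filter, Finset.mem_product, points, Finset.mem_image, Finset.mem_univ,
        true_and, exists_apply_eq_apply, and_self, hre', hlt]
      exact hq
    · rintro ⟨c, c'⟩ - ⟨d, d'⟩ - h
      simp only [Prod.mk.injEq] at h
      rw [hinj h.1, hinj h.2]
    · rintro ⟨a, b⟩ hab
      simp only [Finset.mem_filter, Finset.mem_product, points, Finset.mem_image, Finset.mem_univ,
        true_and] at hab
      obtain ⟨⟨⟨c, rfl⟩, ⟨c', rfl⟩⟩, h⟩ := hab
      rw [hre', hlt] at h
      exact ⟨(c, c'), by simpa using h, rfl⟩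
  rw [h1, Equiv.Perm.ascents, ← Fintype.sum_prod_type', Finset.card_filter]
  push_cast
  rfl

/-- The contribution of the point of `g` in column `c` to `Q`. It collects the case in which the
point is to the lower left of the upper end of its own column, and the crossing of the path `toTop`
with the ray below that end. -/
noncomputable def localQ (c : Fin n) : ℤ := if g.upward c = true ∧ g.row c ≠ D.top c then 1 else 0

/-- An integral function of `g` whose differences are the relative gradings `Q(g) - Q(h)`. -/
noncomputable def potentialQ : ℤ :=
  g.row.ascents D.X + g.row.ascents D.O + ∑ c, g.localQ c

/-- The total level of `g` at the punctures `(c₀, β c₀)`: pairs of points in different columns give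
the ascents, a puncture and the point in its own column the remaining terms. -/
theorem sum_level (β : Equiv.Perm (Fin n)) : ∑ c₀, g.level c₀ (β c₀) = g.row.ascents β +
    ∑ c, ((if g.side c = false ∧ g.row c < β c then 1 else 0) -
      if β c = D.top c then g.nodeCross c else 0) := by
  unfold level Equiv.Perm.ascents
  rw [Finset.sum_comm, ← Finset.sum_add_distrib]
  refine Finset.sum_congr rfl fun c _ => ?_
  have h1 : ∀ c₀, lowerLeft (latticePt c₀ (β c₀)) (g.pt c) =
      (if c < c₀ ∧ g.row c < β c₀ then 1 else 0) +
      (if c₀ = c then (if g.side c = false ∧ g.row c < β c then 1 else 0) else 0) := by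
    intro c₀
    have him : (g.pt c).im < (latticePt c₀ (β c₀)).im ↔ g.row c < β c₀ := by
      rw [pt_im, latticePt, Nat.cast_lt, Fin.lt_def]
    unfold lowerLeft
    simp only [him]
    rw [pt_re, latticePt]
    simp only
    rcases lt_trichotomy c c₀ with h | h | h
    · have : ((c : ℕ) : ℝ) + 1 ≤ (c₀ : ℕ) := by exact_mod_cast h
      have h2 : ((c : ℕ) : ℝ) + (if g.side c then 1 / 4 else -(1 / 4) : ℝ) < (c₀ : ℕ) := by
        split_ifs <;> linarith
      simp only [h2, h, h.ne', if_false, add_zero]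
    · subst h
      cases g.side c <;> simp
    · have : ((c₀ : ℕ) : ℝ) + 1 ≤ (c : ℕ) := by exact_mod_cast h
      have h2 : ¬ ((c : ℕ) : ℝ) + (if g.side c then 1 / 4 else -(1 / 4) : ℝ) < (c₀ : ℕ) := by
        split_ifs <;> linarith
      simp only [h2, h.ne, h.not_gt, false_and, if_false, add_zero]
  have h2 : ∀ c₀, (if c = c₀ ∧ β c₀ = D.top c then g.nodeCross c else 0) =
      if c₀ = c then (if β c = D.top c then g.nodeCross c else 0) else 0 := by
    intro c₀
    by_cases h : c₀ = c
    · subst h; simp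
    · rw [if_neg (fun h' => h h'.1.symm), if_neg h]
  rw [Finset.sum_sub_distrib, Finset.sum_congr rfl fun c₀ _ => h1 c₀,
    Finset.sum_congr rfl fun c₀ _ => h2 c₀, Finset.sum_add_distrib, Finset.sum_ite_eq',
    Finset.sum_ite_eq']
  simp only [Finset.mem_univ, if_true]
  ring

theorem relQ_eq : g.relQ h = ((g.potentialQ - h.potentialQ : ℤ) : ℝ) := by
  have hX : ∀ c, D.X c = D.bot c ∨ D.X c = D.top c := fun c => by
    unfold bot top
    rcases le_total (D.X c) (D.O c) with h | h <;> simp [h]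
  have hO : ∀ c, D.O c = D.bot c ∨ D.O c = D.top c := fun c => by
    unfold bot top
    rcases le_total (D.X c) (D.O c) with h | h <;> simp [h]
  have key : ∀ g : F.Generator,
      ∑ c, (g.level c (D.X c) + g.level c (D.O c)) = g.potentialQ := by
    intro g
    rw [Finset.sum_add_distrib, sum_level, sum_level, potentialQ]
    have : ∑ c, ((if g.side c = false ∧ g.row c < D.X c then 1 else 0) -
          if D.X c = D.top c then g.nodeCross c else 0) +
        ∑ c, ((if g.side c = false ∧ g.row c < D.O c then 1 else 0) -
          if D.O c = D.top c then g.nodeCross c else 0) = ∑ c, g.localQ c := by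
      rw [← Finset.sum_add_distrib]
      refine Finset.sum_congr rfl fun c _ => ?_
      have hV := (g.spec c).2.1
      have hm := F.node_lt_top c
      have hne := D.ne c
      have hbt := D.bot_lt_top c
      have hXO : (D.X c = D.bot c ∧ D.O c = D.top c) ∨ (D.X c = D.top c ∧ D.O c = D.bot c) := by
        rcases hX c with h | h <;> rcases hO c with h' | h'
        · exact absurd (h.trans h'.symm) hne
        · exact Or.inl ⟨h, h'⟩
        · exact Or.inr ⟨h, h'⟩
        · exact absurd (h.trans h'.symm) hne
      -- only the upper end of the column contributes
      unfold localQ nodeCross upward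
      have h1 : ¬ g.row c < D.bot c := not_lt.2 hV.1
      have h2 : g.row c < D.top c ↔ g.row c ≠ D.top c := ⟨fun h => h.ne, lt_of_le_of_ne hV.2⟩
      rcases hXO with ⟨e1, e2⟩ | ⟨e1, e2⟩ <;> rw [e1, e2] <;> by_cases h3 : g.row c ≤ F.node c <;>
        [have h4 : g.row c ≠ D.top c := (h3.trans_lt hm).ne; skip;
          have h4 : g.row c ≠ D.top c := (h3.trans_lt hm).ne; skip] <;>
        cases g.side c <;> simp [h1, h2, h3, hbt.ne, *]
    linarith
  rw [relQ]
  rw [← key, ← key, ← Finset.sum_sub_distrib, Int.cast_sum]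
  refine Finset.sum_congr rfl fun c _ => ?_
  rw [show D.ptX c = latticePt c (D.X c) from rfl, show D.ptO c = latticePt c (D.O c) from rfl,
    loopWinding_eq g h (hX c), loopWinding_eq g h (hO c)]
  push_cast
  ring

end Generator
end FigureEights
end GridDiagram

/-! ### Ascents and concordance of pairs of permutations -/

/-- The sign of `b - a`. -/
def orderSign {n : ℕ} (a b : Fin n) : ℤ := if a < b then 1 else if b < a then -1 else 0

section orderSign

variable {n : ℕ} {a b : Fin n}

theorem orderSign_of_lt (h : a < b) : orderSign a b = 1 := if_pos h

theorem orderSign_of_gt (h : b < a) : orderSign a b = -1 := by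
  rw [orderSign, if_neg h.not_gt, if_pos h]

@[simp]
theorem orderSign_self (a : Fin n) : orderSign a a = 0 := by simp [orderSign]

theorem orderSign_swap (a b : Fin n) : orderSign b a = -orderSign a b := by
  rcases lt_trichotomy a b with h | rfl | h
  · rw [orderSign_of_lt h, orderSign_of_gt h]
  · simp
  · rw [orderSign_of_lt h, orderSign_of_gt h, neg_neg]

theorem two_mul_ite_lt (a b : Fin n) :
    2 * (if a < b then 1 else 0 : ℤ) = 1 + orderSign a b - if a = b then 1 else 0 := by
  rcases lt_trichotomy a b with h | rfl | h
  · rw [orderSign_of_lt h, if_pos h, if_neg h.ne]; norm_num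
  · simp
  · rw [orderSign_of_gt h, if_neg h.not_gt, if_neg h.ne']; norm_num

theorem sum_orderSign : ∑ a : Fin n, ∑ b, orderSign a b = 0 := by
  have h : ∑ a : Fin n, ∑ b, orderSign a b = ∑ a : Fin n, ∑ b, orderSign b a := Finset.sum_comm
  have h2 : ∑ a : Fin n, ∑ b, orderSign b a = -∑ a : Fin n, ∑ b, orderSign a b := by
    simp_rw [← Finset.sum_neg_distrib, ← orderSign_swap]
  linarith

end orderSign

namespace Equiv.Perm

variable {n : ℕ} (α β : Equiv.Perm (Fin n))

/-- The number of concordant minus the number of discordant pairs of columns, as a sum over the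
squares of the grid. -/
def concordance : ℤ := ∑ c, ∑ r, orderSign (α c) r * orderSign c (β.symm r)

theorem concordance_eq :
    concordance α β = ∑ c, ∑ c', orderSign (α c) (β c') * orderSign c c' := by
  refine Finset.sum_congr rfl fun c _ => ?_
  rw [← Equiv.sum_comp β]
  simp

theorem concordance_comm : concordance α β = concordance β α := by
  rw [concordance_eq, concordance_eq, Finset.sum_comm]
  refine Finset.sum_congr rfl fun c _ => Finset.sum_congr rfl fun c' _ => ?_
  rw [orderSign_swap, orderSign_swap c c']
  ring

/-- The asymmetric count of ascents and the symmetric concordance differ by local terms. -/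
theorem four_mul_ascents : 4 * ascents α β = (n : ℤ) ^ 2 - 2 * n + concordance α β +
    ∑ c, ((if α c = β c then 1 else 0) - orderSign (α c) (β c) -
      orderSign c (β.symm (α c))) := by
  have h1 : ∀ c c', 4 * (if c < c' ∧ α c < β c' then 1 else 0 : ℤ) =
      (1 + orderSign c c') + orderSign (α c) (β c') + orderSign (α c) (β c') * orderSign c c' -
      (if c = c' then 1 + orderSign (α c) (β c') - (if α c = β c' then 1 else 0) else 0) -
      (if α c = β c' then 1 + orderSign c c' else 0) := by
    intro c c'
    have e1 := two_mul_ite_lt c c'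
    have e2 := two_mul_ite_lt (α c) (β c')
    have : 4 * (if c < c' ∧ α c < β c' then 1 else 0 : ℤ) =
        (2 * (if c < c' then 1 else 0)) * (2 * (if α c < β c' then 1 else 0)) := by
      by_cases h1 : c < c' <;> by_cases h2 : α c < β c' <;> simp [h1, h2]
    rw [this, e1, e2]
    split_ifs <;> ring
  have h2 : ∑ c, ∑ c', orderSign (α c) (β c') = 0 := by
    rw [Equiv.sum_comp α fun a => ∑ c', orderSign a (β c')]
    simp_rw [fun a => Equiv.sum_comp β fun b => orderSign a b]
    exact sum_orderSign
  have h3 : ∀ c, ∑ c', (if α c = β c' then 1 + orderSign c c' else 0) =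
      1 + orderSign c (β.symm (α c)) := by
    intro c
    have : ∀ c', α c = β c' ↔ c' = β.symm (α c) := fun c' => by
      rw [Equiv.eq_symm_apply]; exact eq_comm
    simp_rw [this]
    rw [Finset.sum_ite_eq']
    simp
  rw [ascents, Finset.mul_sum]
  simp_rw [Finset.mul_sum, h1, Finset.sum_sub_distrib, Finset.sum_add_distrib, h3,
    Finset.sum_ite_eq]
  rw [h2, sum_orderSign, ← concordance_eq]
  simp only [Finset.mem_univ, if_true, Finset.sum_const, Finset.card_univ, Fintype.card_fin,
    Finset.sum_sub_distrib, Finset.sum_add_distrib, nsmul_eq_mul, mul_one]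
  ring

end Equiv.Perm

namespace GridDiagram

variable {n : ℕ} (D : GridDiagram n)

open Equiv.Perm

/-! ### Intersection numbers of the vertical and the horizontal segments -/

/-- Twice the multiplicity of the vertical segment of column `c`, oriented away from height
`row c`, at height `r`; ends of intervals count half. -/
def vertWeight (row : Equiv.Perm (Fin n)) (c r : Fin n) : ℤ :=
  2 * orderSign (row c) r - orderSign (D.bot c) r - orderSign (D.top c) r

/-- Twice the multiplicity of the horizontal segment of row `r`, oriented towards the point in
that row, at abscissa `c`; ends of intervals count half. -/
def horWeight (row : Equiv.Perm (Fin n)) (c r : Fin n) : ℤ :=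
  2 * orderSign c (row.symm r) - orderSign c (D.left r) - orderSign c (D.right r)

theorem apply_bot_add_top {M : Type*} [AddCommMonoid M] (f : Fin n → M) (c : Fin n) :
    f (D.bot c) + f (D.top c) = f (D.X c) + f (D.O c) := by
  unfold bot top
  rcases le_total (D.X c) (D.O c) with h | h <;> simp [h, add_comm]

theorem apply_left_add_right {M : Type*} [AddCommMonoid M] (f : Fin n → M) (r : Fin n) :
    f (D.left r) + f (D.right r) = f (D.X.symm r) + f (D.O.symm r) := by
  unfold left right
  rcases le_total (D.X.symm r) (D.O.symm r) with h | h <;> simp [h, add_comm]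

/-- The weights are combinations of order signs, so the total intersection number of the vertical
and the horizontal segments is a combination of concordances. -/
theorem sum_vertWeight_mul_horWeight (row : Equiv.Perm (Fin n)) :
    ∑ c, ∑ r, D.vertWeight row c r * D.horWeight row c r =
      4 * concordance row row - 4 * concordance row D.X - 4 * concordance row D.O +
      (concordance D.X D.X + 2 * concordance D.X D.O + concordance D.O D.O) := by
  have h1 : ∀ c r, D.vertWeight row c r * D.horWeight row c r =
      4 * (orderSign (row c) r * orderSign c (row.symm r)) -
      2 * (orderSign (row c) r * orderSign c (D.X.symm r)) -
      2 * (orderSign (row c) r * orderSign c (D.O.symm r)) -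
      2 * (orderSign (D.X c) r * orderSign c (row.symm r)) -
      2 * (orderSign (D.O c) r * orderSign c (row.symm r)) +
      orderSign (D.X c) r * orderSign c (D.X.symm r) +
      orderSign (D.X c) r * orderSign c (D.O.symm r) +
      orderSign (D.O c) r * orderSign c (D.X.symm r) +
      orderSign (D.O c) r * orderSign c (D.O.symm r) := by
    intro c r
    have e1 := D.apply_bot_add_top (fun a => orderSign a r) c
    have e2 := D.apply_left_add_right (fun a => orderSign c a) r
    rw [vertWeight, horWeight, sub_sub, sub_sub, e1, e2]
    ring
  simp_rw [h1, Finset.sum_add_distrib, Finset.sum_sub_distrib, ← Finset.mul_sum]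
  have e1 := concordance_comm D.X row
  have e2 := concordance_comm D.O row
  have e3 := concordance_comm D.O D.X
  unfold concordance at *
  linarith

theorem vertWeight_of_mem (row : Equiv.Perm (Fin n)) {c r : Fin n}
    (h : D.bot c < r ∧ r < D.top c) : D.vertWeight row c r = 2 * orderSign (row c) r := by
  rw [vertWeight, orderSign_of_lt h.1, orderSign_of_gt h.2]; ring

theorem horWeight_of_mem (row : Equiv.Perm (Fin n)) {c r : Fin n}
    (h : D.left r < c ∧ c < D.right r) :
    D.horWeight row c r = 2 * orderSign c (row.symm r) := by
  rw [horWeight, orderSign_of_gt h.1, orderSign_of_lt h.2]; ring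

theorem vertWeight_eq_zero {row : Equiv.Perm (Fin n)}
    (hV : ∀ c, D.bot c ≤ row c ∧ row c ≤ D.top c) {c r : Fin n}
    (h : ¬ (D.bot c ≤ r ∧ r ≤ D.top c)) :
    D.vertWeight row c r = 0 := by
  have hv := hV c
  have hbt := D.bot_lt_top c
  rcases not_and_or.1 h with h | h
  · rw [not_le] at h
    rw [vertWeight, orderSign_of_gt h, orderSign_of_gt (h.trans hbt),
      orderSign_of_gt (h.trans_le hv.1)]
    ring
  · rw [not_le] at h
    rw [vertWeight, orderSign_of_lt h, orderSign_of_lt (hbt.trans h),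
      orderSign_of_lt (hv.2.trans_lt h)]
    ring

theorem horWeight_eq_zero {row : Equiv.Perm (Fin n)}
    (hH : ∀ r, D.left r ≤ row.symm r ∧ row.symm r ≤ D.right r) {c r : Fin n}
    (h : ¬ (D.left r ≤ c ∧ c ≤ D.right r)) :
    D.horWeight row c r = 0 := by
  have hv := hH r
  have hbt := D.left_lt_right r
  rcases not_and_or.1 h with h | h
  · rw [not_le] at h
    rw [horWeight, orderSign_of_lt h, orderSign_of_lt (h.trans hbt),
      orderSign_of_lt (h.trans_le hv.1)]
    ring
  · rw [not_le] at h
    rw [horWeight, orderSign_of_gt h, orderSign_of_gt (hbt.trans h),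
      orderSign_of_gt (hv.2.trans_lt h)]
    ring

/-- At the lower corner of a column the product of the weights is the corner sign. -/
theorem weight_mul_bot {row : Equiv.Perm (Fin n)} (hV : ∀ c, D.bot c ≤ row c ∧ row c ≤ D.top c)
    (hH : ∀ r, D.left r ≤ row.symm r ∧ row.symm r ≤ D.right r) (c : Fin n) :
    D.vertWeight row c (D.bot c) * D.horWeight row c (D.bot c) = D.cornerSign c (D.bot c) := by
  have hbt := D.bot_lt_top c
  have hlr := D.left_lt_right (D.bot c)
  have hh := hH (D.bot c)
  have hc := (D.corner_iff c (D.bot c)).1 (Or.inl rfl)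
  have hiff : row c = D.bot c ↔ row.symm (D.bot c) = c := by
    rw [Equiv.symm_apply_eq]; exact eq_comm
  unfold vertWeight horWeight cornerSign
  rw [orderSign_self, orderSign_of_gt hbt]
  by_cases h : row c = D.bot c
  · rw [h, hiff.1 h]
    rcases hc with hc | hc
    · rw [← hc] at hlr ⊢
      rw [orderSign_of_lt hlr, if_neg hlr.ne]; simp
    · rw [← hc] at hlr ⊢
      rw [orderSign_of_gt hlr, if_pos rfl]; simp
  · rw [orderSign_of_gt (lt_of_le_of_ne (hV c).1 (Ne.symm h))]
    have h' : row.symm (D.bot c) ≠ c := fun h' => h (hiff.2 h')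
    rcases hc with hc | hc
    · rw [← hc] at hlr hh ⊢
      rw [orderSign_of_lt hlr, if_neg hlr.ne, orderSign_of_lt (lt_of_le_of_ne hh.1 h'.symm)]; simp
    · rw [← hc] at hlr hh ⊢
      rw [orderSign_of_gt hlr, if_pos rfl, orderSign_of_gt (lt_of_le_of_ne hh.2 h')]; simp

/-- At the upper corner of a column the product of the weights is minus the corner sign. -/
theorem weight_mul_top {row : Equiv.Perm (Fin n)} (hV : ∀ c, D.bot c ≤ row c ∧ row c ≤ D.top c)
    (hH : ∀ r, D.left r ≤ row.symm r ∧ row.symm r ≤ D.right r) (c : Fin n) :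
    D.vertWeight row c (D.top c) * D.horWeight row c (D.top c) = -D.cornerSign c (D.top c) := by
  have hbt := D.bot_lt_top c
  have hlr := D.left_lt_right (D.top c)
  have hh := hH (D.top c)
  have hc := (D.corner_iff c (D.top c)).1 (Or.inr rfl)
  have hiff : row c = D.top c ↔ row.symm (D.top c) = c := by
    rw [Equiv.symm_apply_eq]; exact eq_comm
  unfold vertWeight horWeight cornerSign
  rw [orderSign_self, orderSign_of_lt hbt]
  by_cases h : row c = D.top c
  · rw [h, hiff.1 h]
    rcases hc with hc | hc
    · rw [← hc] at hlr ⊢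
      rw [orderSign_of_lt hlr, if_neg hlr.ne]; simp
    · rw [← hc] at hlr ⊢
      rw [orderSign_of_gt hlr, if_pos rfl]; simp
  · rw [orderSign_of_lt (lt_of_le_of_ne (hV c).2 h)]
    have h' : row.symm (D.top c) ≠ c := fun h' => h (hiff.2 h')
    rcases hc with hc | hc
    · rw [← hc] at hlr hh ⊢
      rw [orderSign_of_lt hlr, if_neg hlr.ne, orderSign_of_lt (lt_of_le_of_ne hh.1 h'.symm)]; simp
    · rw [← hc] at hlr hh ⊢
      rw [orderSign_of_gt hlr, if_pos rfl, orderSign_of_gt (lt_of_le_of_ne hh.2 h')]; simp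

/-- A sum over the crossings as a sum over the grid. -/
theorem sum_crossing (f : Fin n → Fin n → ℤ) : ∑ x : D.Crossing, f x.1.1 x.1.2 =
    ∑ c, ∑ r, if (D.bot c < r ∧ r < D.top c) ∧ (D.left r < c ∧ c < D.right r) then f c r else 0 := by
  rw [← Fintype.sum_prod_type', ← Finset.sum_filter,
    Finset.sum_subtype (p := fun p : Fin n × Fin n => (D.bot p.1 < p.2 ∧ p.2 < D.top p.1) ∧
      (D.left p.2 < p.1 ∧ p.1 < D.right p.2)) (Finset.univ.filter _) (by simp)]

/-- The weights have no common support except at crossings and corners. -/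
theorem sum_crossing_weight {row : Equiv.Perm (Fin n)}
    (hV : ∀ c, D.bot c ≤ row c ∧ row c ≤ D.top c)
    (hH : ∀ r, D.left r ≤ row.symm r ∧ row.symm r ≤ D.right r) :
    ∑ x : D.Crossing, 4 * (orderSign (row x.1.1) x.1.2 * orderSign x.1.1 (row.symm x.1.2)) =
      ∑ c, ∑ r, D.vertWeight row c r * D.horWeight row c r +
        ∑ c, (D.cornerSign c (D.top c) - D.cornerSign c (D.bot c)) := by
  rw [D.sum_crossing fun c r => 4 * (orderSign (row c) r * orderSign c (row.symm r)),
    ← Finset.sum_add_distrib]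
  refine Finset.sum_congr rfl fun c _ => ?_
  have hbt := D.bot_lt_top c
  have h1 : ∀ r, D.vertWeight row c r * D.horWeight row c r =
      (if (D.bot c < r ∧ r < D.top c) ∧ (D.left r < c ∧ c < D.right r) then
        4 * (orderSign (row c) r * orderSign c (row.symm r)) else 0) +
      (if r = D.bot c then D.cornerSign c (D.bot c) else 0) +
      (if r = D.top c then -D.cornerSign c (D.top c) else 0) := by
    intro r
    by_cases hb : r = D.bot c
    · subst hb
      rw [D.weight_mul_bot hV hH, if_pos rfl, if_neg hbt.ne, if_neg (fun h => lt_irrefl _ h.1.1)]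
      ring
    by_cases ht : r = D.top c
    · subst ht
      rw [D.weight_mul_top hV hH, if_pos rfl, if_neg hb, if_neg (fun h => lt_irrefl _ h.1.2)]
      ring
    rw [if_neg hb, if_neg ht, add_zero, add_zero]
    have hcor : ¬ (c = D.left r ∨ c = D.right r) := by
      rw [← D.corner_iff]; tauto
    rw [not_or] at hcor
    split_ifs with hx
    · rw [D.vertWeight_of_mem row hx.1, D.horWeight_of_mem row hx.2]
      ring
    · by_cases h2 : D.bot c ≤ r ∧ r ≤ D.top c
      · rw [D.horWeight_eq_zero hH, mul_zero]
        intro h3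
        exact hx ⟨⟨lt_of_le_of_ne h2.1 (Ne.symm hb), lt_of_le_of_ne h2.2 ht⟩,
          lt_of_le_of_ne h3.1 (Ne.symm hcor.1), lt_of_le_of_ne h3.2 hcor.2⟩
      · rw [D.vertWeight_eq_zero hV h2, zero_mul]
  simp_rw [h1, Finset.sum_add_distrib, Finset.sum_ite_eq']
  simp only [Finset.mem_univ, if_true]
  ring

/-! ### Comparison of the two gradings -/

namespace FigureEights.Generator

variable {D} {F : D.FigureEights} (g : F.Generator)

theorem row_symm_mem (r : Fin n) : D.left r ≤ g.row.symm r ∧ g.row.symm r ≤ D.right r := by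
  simpa using (g.spec (g.row.symm r)).2.2

theorem phi_smoothing (x : D.Crossing) : g.phi.smoothing x =
    if g.row x.1.1 = x.1.2 then !g.upward x.1.1
    else decide (g.row x.1.1 < x.1.2 ↔ x.1.1 < g.row.symm x.1.2) := rfl

/-- The number of `1`-smoothings of `φ(g)`: away from the points of `g`, a crossing gets its
`1`-smoothing if the signs of its two strands agree. -/
theorem four_mul_numOne : 4 * (g.phi.numOne : ℤ) = ∑ x : D.Crossing, (2 +
      2 * (orderSign (g.row x.1.1) x.1.2 * orderSign x.1.1 (g.row.symm x.1.2))) +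
    ∑ c, 2 * smoothingSign g.phi.smoothing c (g.row c) := by
  have h1 : ∑ c, 2 * smoothingSign g.phi.smoothing c (g.row c) =
      ∑ x : D.Crossing, (if g.row x.1.1 = x.1.2 then
        2 * smoothingSign g.phi.smoothing x.1.1 x.1.2 else 0) := by
    rw [D.sum_crossing fun c r => if g.row c = r then
      2 * smoothingSign g.phi.smoothing c r else 0]
    refine Finset.sum_congr rfl fun c _ => ?_
    have : ∀ r, (if (D.bot c < r ∧ r < D.top c) ∧ (D.left r < c ∧ c < D.right r) then
        (if g.row c = r then 2 * smoothingSign g.phi.smoothing c r else 0) else 0) =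
        if g.row c = r then 2 * smoothingSign g.phi.smoothing c r else 0 := by
      intro r
      split_ifs with h1 h2 h2
      · rfl
      · rfl
      · rw [smoothingSign_of_not h1, mul_zero]
      · rfl
    simp_rw [this]
    rw [Finset.sum_ite_eq]
    simp
  rw [h1, ← Finset.sum_add_distrib, KauffmanState.numOne, Finset.card_filter]
  push_cast
  rw [Finset.mul_sum]
  refine Finset.sum_congr rfl fun x _ => ?_
  rw [smoothingSign_of_crossing, phi_smoothing]
  have h2 : g.row x.1.1 = x.1.2 ↔ g.row.symm x.1.2 = x.1.1 := by
    rw [Equiv.symm_apply_eq]; exact eq_comm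
  by_cases h : g.row x.1.1 = x.1.2
  · rw [if_pos h, if_pos h, h2.1 h, h]
    cases g.upward x.1.1 <;> simp
  · rw [if_neg h, if_neg h]
    have h' : g.row.symm x.1.2 ≠ x.1.1 := fun h' => h (h2.2 h')
    rcases lt_or_gt_of_ne h with h3 | h3 <;> rcases lt_or_gt_of_ne h' with h4 | h4
    · simp [orderSign_of_lt h3, orderSign_of_gt h4, h3, h4.not_gt]
    · simp [orderSign_of_lt h3, orderSign_of_lt h4, h3, h4]
    · simp [orderSign_of_gt h3, orderSign_of_gt h4, h3.not_gt, h4.not_gt]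
    · simp [orderSign_of_gt h3, orderSign_of_lt h4, h3.not_gt, h4]

/-- All local contributions of a point of `g` add up to a quantity which does not depend
on `g`. -/
theorem local_identity (c : Fin n) :
    -4 * (((if g.row c = D.X c then 1 else 0) - orderSign (g.row c) (D.X c) -
        orderSign c (D.X.symm (g.row c))) + ((if g.row c = D.O c then 1 else 0) -
        orderSign (g.row c) (D.O c) - orderSign c (D.O.symm (g.row c)))) -
      16 * g.localQ c -
      2 * (D.cornerSign c (D.bot c) * (if g.row c = D.bot c then 1 else -1) +
        D.cornerSign c (D.top c) * (if g.row c = D.top c then -1 else 1)) -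
      8 * smoothingSign g.phi.smoothing c (g.row c) =
    -8 + 2 * D.cornerSign c (D.bot c) - 2 * D.cornerSign c (D.top c) := by
  have e1 := D.apply_bot_add_top (fun r => (if g.row c = r then 1 else 0 : ℤ)) c
  have e2 := D.apply_bot_add_top (fun r => orderSign (g.row c) r) c
  have e3 := D.apply_left_add_right (fun d => orderSign c d) (g.row c)
  have hV := (g.spec c).2.1
  have hlr := D.left_lt_right (g.row c)
  have hbt := D.bot_lt_top c
  have hcor := D.corner_iff c (g.row c)
  have hside := g.left_right_of_side c
  have hm := F.node_lt_top c
  have hm' := F.bot_le_node c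
  suffices -4 * (((if g.row c = D.bot c then 1 else 0) + (if g.row c = D.top c then 1 else 0)) -
        (orderSign (g.row c) (D.bot c) + orderSign (g.row c) (D.top c)) -
        (orderSign c (D.left (g.row c)) + orderSign c (D.right (g.row c)))) -
      16 * g.localQ c -
      2 * (D.cornerSign c (D.bot c) * (if g.row c = D.bot c then 1 else -1) +
        D.cornerSign c (D.top c) * (if g.row c = D.top c then -1 else 1)) -
      8 * smoothingSign g.phi.smoothing c (g.row c) =
    -8 + 2 * D.cornerSign c (D.bot c) - 2 * D.cornerSign c (D.top c) by linarith
  by_cases hp : g.row c = D.bot c ∨ g.row c = D.top c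
  · -- the point of `g` is next to a puncture
    rw [smoothingSign_of_not (by
      rintro ⟨⟨h1, h2⟩, -⟩; rcases hp with h | h <;> simp [h] at h1 h2)]
    have hc := hcor.1 hp
    unfold localQ upward
    rcases hp with hp | hp
    · rw [hp] at hc hlr hside ⊢
      rw [if_pos rfl, if_pos rfl, if_neg hbt.ne, if_neg hbt.ne, orderSign_self,
        orderSign_of_lt hbt]
      rcases hc with hc | hc
      · have hk : D.cornerSign c (D.bot c) = -1 := if_neg (hc.trans_ne hlr.ne)
        rw [← hc] at hlr hside ⊢
        -- the row ends here, so the point is on the inner side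
        have : g.side c = true := by
          by_contra h
          rw [if_neg h] at hside
          exact lt_irrefl _ hside.1
        rw [orderSign_self, orderSign_of_lt hlr, hk]
        simp [this, hm', hbt.ne]
        ring
      · have hk : D.cornerSign c (D.bot c) = 1 := if_pos hc
        rw [← hc] at hlr hside ⊢
        -- the row ends here, so the point is on the inner side
        have : g.side c = false := by
          by_contra h
          rw [if_pos (by simpa using h)] at hside
          exact lt_irrefl _ hside.2
        rw [orderSign_self, orderSign_of_gt hlr, hk]
        simp [this, hm']
        ring
    · rw [hp] at hc hlr hside ⊢
      rw [if_pos rfl, if_pos rfl, if_neg hbt.ne', if_neg hbt.ne', orderSign_self,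
        orderSign_of_gt hbt]
      rcases hc with hc | hc
      · have hk : D.cornerSign c (D.top c) = -1 := if_neg (hc.trans_ne hlr.ne)
        rw [← hc] at hlr ⊢
        rw [orderSign_self, orderSign_of_lt hlr, hk]
        simp
        ring
      · have hk : D.cornerSign c (D.top c) = 1 := if_pos hc
        rw [← hc] at hlr ⊢
        rw [orderSign_self, orderSign_of_gt hlr, hk]
        simp
        ring
  · -- the point of `g` is next to a crossing
    rw [not_or] at hp
    have hx1 : D.bot c < g.row c ∧ g.row c < D.top c :=
      ⟨lt_of_le_of_ne hV.1 (Ne.symm hp.1), lt_of_le_of_ne hV.2 hp.2⟩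
    have hx2 : D.left (g.row c) < c ∧ c < D.right (g.row c) := by
      have h := (g.spec c).2.2
      have hne : ¬ (c = D.left (g.row c) ∨ c = D.right (g.row c)) := by
        rw [← hcor]; tauto
      rw [not_or] at hne
      exact ⟨lt_of_le_of_ne h.1 (Ne.symm hne.1), lt_of_le_of_ne h.2 hne.2⟩
    have hs := smoothingSign_of_crossing g.phi.smoothing ⟨(c, g.row c), hx1, hx2⟩
    rw [phi_smoothing] at hs
    simp only [if_true] at hs
    rw [hs, if_neg hp.1, if_neg hp.2, if_neg hp.1, if_neg hp.2, orderSign_of_gt hx1.1,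
      orderSign_of_lt hx1.2, orderSign_of_gt hx2.1, orderSign_of_lt hx2.2]
    unfold localQ
    cases g.upward c <;> simp [hp.2] <;> ring

/-- The difference of the two gradings takes the same value on all generators. -/
theorem exists_const (F : D.FigureEights) : ∃ K : ℤ, ∀ g : F.Generator,
    8 * (2 * (g.T : ℤ) - 2 * g.potentialQ - g.phi.rot - g.phi.numOne) = K := by
  -- the value is what remains of the local contributions after the concordances of `g` cancel
  refine ⟨-4 * ((n : ℤ) ^ 2 - 2 * n) + 4 * n - (concordance D.X D.X + 2 * concordance D.X D.O +
    concordance D.O D.O) - 2 * ∑ x : D.Crossing, 2 +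
    ∑ c, (-8 + 3 * D.cornerSign c (D.bot c) - 3 * D.cornerSign c (D.top c)), fun g => ?_⟩
  have hV := fun c => (g.spec c).2.1
  have h1 := four_mul_ascents g.row g.row
  have h2 := four_mul_ascents g.row D.X
  have h3 := four_mul_ascents g.row D.O
  have h4 := g.phi.four_mul_rot_of_orient g.row rfl hV
  have h5 := g.four_mul_numOne
  have h6 := D.sum_crossing_weight hV g.row_symm_mem
  have h7 := D.sum_vertWeight_mul_horWeight g.row
  have h8 := Finset.sum_congr rfl fun c (_ : c ∈ Finset.univ) => g.local_identity c
  simp only [if_true, orderSign_self, Equiv.symm_apply_apply, sub_zero, Finset.sum_const,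
    Finset.card_univ, Fintype.card_fin, nsmul_eq_mul, mul_one] at h1
  rw [g.T_eq, potentialQ]
  simp only [Finset.sum_add_distrib, Finset.sum_sub_distrib, ← Finset.mul_sum] at *
  linarith

/-- The generator of the points nearest to the `X`'s corresponds to the oriented resolution. -/
theorem seifertState_eq (F : D.FigureEights) : D.seifertState = (x F).phi := by
  have h1 : D.seifertState.orient = (x F).phi.orient := by
    funext e
    rcases e with ⟨⟨c, k⟩, h⟩ | ⟨⟨k, r⟩, h⟩
    · simp only [seifertState, phi, x, vertUp, orientOf, bot, top] at h ⊢
      rcases le_total (D.X c) (D.O c) with h' | h' <;> simp [h'] at h <;> congr 1 <;>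
        simp only [eq_iff_iff] <;> omega
    · simp only [seifertState, phi, x, horRight, orientOf, left, right] at h ⊢
      rcases le_total (D.X.symm r) (D.O.symm r) with h' | h' <;> simp [h'] at h <;>
        congr 1 <;> simp only [eq_iff_iff] <;> omega
  have h2 : D.seifertState.smoothing = (x F).phi.smoothing := by
    funext y
    obtain ⟨⟨c, r⟩, h⟩ := y
    rw [phi_smoothing]
    have h0 : D.X c ≠ r := by
      rintro rfl
      unfold bot top at h
      rcases le_total (D.X c) (D.O c) with h' | h' <;> simp [h'] at h
    rw [if_neg (show ¬ (x F).row c = r from h0)]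
    have h1 : D.X.symm r ≠ c := fun h => h0 (by simp [← h])
    have k1 : D.X c < D.O c ↔ D.X c < r := by
      have h := h.1
      unfold bot top at h
      rcases le_total (D.X c) (D.O c) with h' | h' <;> simp [h'] at h <;> omega
    have k2 : D.O.symm r < D.X.symm r ↔ c < D.X.symm r := by
      have h := h.2
      unfold left right at h
      rcases le_total (D.X.symm r) (D.O.symm r) with h' | h' <;> simp [h'] at h <;> omega
    show (!(decide (D.X c < D.O c) != decide (D.O.symm r < D.X.symm r))) =
      decide (D.X c < r ↔ c < D.X.symm r)
    simp only [k1, k2]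
    by_cases h2 : D.X c < r <;> by_cases h3 : c < D.X.symm r <;> simp [h2, h3]
  have h3 : ∀ S S' : D.KauffmanState, S.orient = S'.orient → S.smoothing = S'.smoothing →
      S = S' := by
    rintro ⟨s, o, h⟩ ⟨s', o', h'⟩ rfl rfl
    rfl
  exact h3 _ _ h1 h2

theorem numOne_x (F : D.FigureEights) : (x F).phi.numOne = D.nMinus := by
  rw [← seifertState_eq]
  unfold KauffmanState.numOne nMinus seifertState
  simp

theorem writhe_eq (D : GridDiagram n) : D.writhe = D.nPlus - D.nMinus := by
  unfold writhe nPlus nMinus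
  rw [Finset.card_filter, Finset.card_filter]
  push_cast
  rw [← Finset.sum_sub_distrib]
  refine Finset.sum_congr rfl fun y _ => ?_
  cases D.Positive y <;> simp

theorem J_eq_quantumGrading : g.J = (D.quantumGrading g.phi : ℝ) := by
  obtain ⟨K, hK⟩ := exists_const F
  have h1 := hK g
  -- the constant is determined by the generator `x`
  have h2 := hK (x F)
  have h3 : D.rot = (x F).phi.rot := by rw [rot, seifertState_eq F]
  have h4 := writhe_eq D
  rw [numOne_x, ← h3] at h2
  rw [J, Q, relQ_eq, quantumGrading]
  have h5 : 2 * ((g.T : ℤ) - (g.potentialQ - (x F).potentialQ)) - 2 * ((x F).T : ℤ) + D.rot +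
      D.writhe = g.phi.rot + g.phi.numOne + D.nPlus - 2 * D.nMinus := by
    linarith
  exact_mod_cast h5

end FigureEights.Generator

end GridDiagram

theorem mainTheorem2 {n : ℕ} (hn : 2 ≤ n) (D : GridDiagram n) (F : D.FigureEights)
    (g : F.Generator) : g.J = (D.quantumGrading g.phi : ℝ) :=
  g.J_eq_quantumGrading
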